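/- Let $a_1<a_2<a_3<a_4$ be real numbers. There is a (necessarily unique) bounded linear operator $H_T:L^2(a_2,a_4)\to L^2(a_1,a_3)$ between complex $L^2$ spaces, the truncated Hilbert transform with overlap, such that for every $f\in L^2(a_2,a_4)$ and almost every $x\in(a_1,a_3)$ $$(H_Tf)(x)=\frac1\pi\,\mathrm{p.v.}\!\int_{a_2}^{a_4}\frac{f(y)}{y-x}\,dy=\frac1\pi\lim_{\varepsilon\to0^+}\int_{\{y\in(a_2,a_4):\,|y-x|>\varepsilon\}}\frac{f(y)}{y-x}\,dy,$$ where the limit exists. Call $\sigma\ge0$ a singular value of $H_T$ if there are unit vectors $f\in L^2(a_2,a_4)$ and $g\in L^2(a_1,a_3)$ with $H_Tf=\sigma g$ and $H_T^*g=\sigma f$. Then: 1. $0$ and $1$ both belong to the spectrum of $H_T^*H_T$; 2. neither $0$ nor $1$ is an eigenvalue of $H_T^*H_T$; 3. $0$ and $1$ are both accumulation points of the set of singular values of $H_T$; 4. $H_T$ is not compact. -/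

import Mathlib

open MeasureTheory Filter Topology

/-- The Hilbert space `L²(a, b)` of complex-valued square-integrable functions on `(a, b)`. -/
abbrev L2Interval (a b : ℝ) : Type :=
  Lp ℂ 2 (volume.restrict (Set.Ioo a b))

/-- The integral of `f(y) / (y - x)` over `y ∈ (a, b)` with `|y - x| > ε`, divided by `π`. -/
noncomputable def cutoffHilbert (a b : ℝ) (f : ℝ → ℂ) (x ε : ℝ) : ℂ :=
  (1 / (Real.pi : ℂ)) * ∫ y in {y : ℝ | y ∈ Set.Ioo a b ∧ ε < |y - x|}, f y / ((y : ℂ) - (x : ℂ))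

/-- The value `v` is `(1 / π) p.v. ∫_a^b f(y) / (y - x) dy`; the principal value exists. -/
def HasPVHilbert (a b : ℝ) (f : ℝ → ℂ) (x : ℝ) (v : ℂ) : Prop :=
  Tendsto (fun ε : ℝ => cutoffHilbert a b f x ε) (𝓝[>] 0) (𝓝 v)

/-- The bounded operator `T : L²(a₂, a₄) → L²(a₁, a₃)` is the truncated Hilbert transform:
for every `f`, the principal value exists and equals `(T f)(x)` for almost every
`x ∈ (a₁, a₃)`. -/
def IsTruncatedHilbert (a₁ a₂ a₃ a₄ : ℝ)
    (T : L2Interval a₂ a₄ →L[ℂ] L2Interval a₁ a₃) : Prop :=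
  ∀ f : L2Interval a₂ a₄, ∀ᵐ x ∂(volume.restrict (Set.Ioo a₁ a₃)),
    HasPVHilbert a₂ a₄ (f : ℝ → ℂ) x ((T f : L2Interval a₁ a₃) x)

/-- The defining property determines the operator, so "the" truncated Hilbert transform makes
sense. -/
theorem IsTruncatedHilbert.unique {a₁ a₂ a₃ a₄ : ℝ}
    {S T : L2Interval a₂ a₄ →L[ℂ] L2Interval a₁ a₃}
    (hS : IsTruncatedHilbert a₁ a₂ a₃ a₄ S) (hT : IsTruncatedHilbert a₁ a₂ a₃ a₄ T) : S = T := by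
  refine ContinuousLinearMap.ext fun f => Lp.ext ?_
  filter_upwards [hS f, hT f] with x hx hy
  exact tendsto_nhds_unique hx hy

/-- `σ ≥ 0` is a singular value of `T`: there are unit vectors `f`, `g` with
`T f = σ g` and `T^* g = σ f`. -/
def IsSingularValue {E F : Type*} [NormedAddCommGroup E] [InnerProductSpace ℂ E] [CompleteSpace E]
    [NormedAddCommGroup F] [InnerProductSpace ℂ F] [CompleteSpace F]
    (T : E →L[ℂ] F) (σ : ℝ) : Prop :=
  0 ≤ σ ∧ ∃ (f : E) (g : F), ‖f‖ = 1 ∧ ‖g‖ = 1 ∧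
    T f = (σ : ℂ) • g ∧ ContinuousLinearMap.adjoint T g = (σ : ℂ) • f

/-! Let `H` be the Hilbert transform on the line, `P` the cutoff to `(a₁, a₃)` and `Q` the cutoff to
`(a₂, a₄)`. Since `H² = -1` and `H* = -H`, the operator `A = T* T` is the compression of `-H P H` to
`L²(a₂, a₄)`, and `1 - A` is the same expression with `P` replaced by `1 - P`. So `A (1 - A)`
contains the factor `P H Q H (1 - P)`.

The commutator of `H` with a Lipschitz function of bounded support has a square-integrable kernel,
hence is compact. The jumps of `P` and `Q` are separated, because `a₁, a₂, a₃, a₄` are distinct and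
ordered. Splitting `Q` into Lipschitz pieces therefore makes `P H Q H (1 - P)`, and with it `A (1 -
A)`, compact (`isCompactOperator_core`). By the spectral theorem the eigenvectors of `A` span a
dense subspace.

Functions supported near `a₄` are far from `(a₁, a₃)`, so `A` is compact on them; functions
supported near `a₂` are far from the complement of `(a₁, a₃)`, so `1 - A` is compact on them.
Multiplication by the indicator of an interval is not compact. Hence neither `A` nor `1 - A` is
invertible, and `T` is not compact.

An eigenvector of `A` for `0` or `1` would have a Hilbert transform vanishing on an interval to the
left of its support. There the transform is smooth with derivatives given by moments in `1 / (y -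
x)`, and Weierstrass approximation forces the function to vanish (`eq_zero_of_hilbertLine_eq_zero`).
Thus `0` and `1` are spectral points but not eigenvalues, and density of eigenvectors makes distinct
eigenvalues accumulate at each; their square roots are singular values.

The transform itself is built as `-i` times the reflection in a Hardy space, and identified with the
principal value by Poisson integrals at Lebesgue points (`ae_tendsto_hilbertLine`). -/

section Hilbert

/-! ### Compactness criteria and self-adjoint operators on Hilbert spaces -/

variable {E F : Type*} [NormedAddCommGroup E] [InnerProductSpace ℂ E]
  [NormedAddCommGroup F] [InnerProductSpace ℂ F] [CompleteSpace F]

/-- An operator with square-summable values on a Hilbert basis is compact. -/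
theorem isCompactOperator_of_summable_norm_sq {ι : Type*} (b : HilbertBasis ι ℂ E) (K : E →L[ℂ] F)
    (h : Summable fun i => ‖K (b i)‖ ^ 2) : IsCompactOperator K := by
  classical
  set S : ℝ := ∑' i, ‖K (b i)‖ ^ 2
  -- Finite-rank truncations of `K`; Cauchy–Schwarz and Bessel bound the error in operator norm by
  -- the square root of the tail of the series.
  let G : Finset ι → E →L[ℂ] F := fun s => ∑ i ∈ s, (innerSL ℂ (b i)).smulRight (K (b i))
  have hG : ∀ s x, G s x = ∑ i ∈ s, inner ℂ (b i) x • K (b i) := fun s x => by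
    simp [G]
  have hbound : ∀ s, ‖G s - K‖ ≤ √(S - ∑ i ∈ s, ‖K (b i)‖ ^ 2) := by
    intro s
    refine ContinuousLinearMap.opNorm_le_bound _ (Real.sqrt_nonneg _) fun x => ?_
    have hlim : Tendsto (fun t : Finset ι => ‖G s x - G t x‖) atTop (𝓝 ‖(G s - K) x‖) := by
      have h1 : Tendsto (fun t : Finset ι => ∑ i ∈ t, b.repr x i • b i) atTop (𝓝 x) :=
        b.hasSum_repr x
      have h2 := (K.continuous.tendsto x).comp h1
      have h3 : (K ∘ fun t : Finset ι => ∑ i ∈ t, b.repr x i • b i) = fun t => G t x := by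
        funext t
        simp [hG, map_sum, b.repr_apply_apply]
      rw [h3] at h2
      exact (h2.const_sub (G s x)).norm
    refine le_of_tendsto hlim ?_
    filter_upwards [eventually_ge_atTop s] with t hst
    have h1 : G t x - G s x = ∑ i ∈ t \ s, inner ℂ (b i) x • K (b i) := by
      rw [hG, hG, ← Finset.sum_sdiff hst, add_sub_cancel_right]
    rw [norm_sub_rev, h1]
    calc ‖∑ i ∈ t \ s, inner ℂ (b i) x • K (b i)‖
        ≤ ∑ i ∈ t \ s, ‖inner ℂ (b i) x‖ * ‖K (b i)‖ := by
          refine (norm_sum_le _ _).trans (Finset.sum_le_sum fun i _ => (norm_smul_le _ _))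
      _ ≤ √(∑ i ∈ t \ s, ‖inner ℂ (b i) x‖ ^ 2) * √(∑ i ∈ t \ s, ‖K (b i)‖ ^ 2) :=
          Real.sum_mul_le_sqrt_mul_sqrt _ _ _
      _ ≤ ‖x‖ * √(S - ∑ i ∈ s, ‖K (b i)‖ ^ 2) := by
          gcongr
          · exact Real.sqrt_le_iff.2 ⟨norm_nonneg _, b.orthonormal.sum_inner_products_le x⟩
          · rw [le_sub_iff_add_le, Finset.sum_sdiff hst]
            exact h.sum_le_tsum _ fun i _ => by positivity
      _ = _ := mul_comm _ _
  have hG' : Tendsto G atTop (𝓝 K) := by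
    rw [tendsto_iff_norm_sub_tendsto_zero]
    refine squeeze_zero (fun _ => norm_nonneg _) hbound ?_
    have : Tendsto (fun s => S - ∑ i ∈ s, ‖K (b i)‖ ^ 2) atTop (𝓝 (S - S)) :=
      h.hasSum.const_sub S
    simpa using this.sqrt
  refine isCompactOperator_of_tendsto hG' (Eventually.of_forall fun s => ?_)
  exact Submodule.sum_mem (compactOperator (RingHom.id ℂ) E F) fun i _ =>
    (isCompactOperator_id (E := ℂ)).comp_clm (innerSL ℂ (b i)) |>.clm_comp
      ((1 : ℂ →L[ℂ] ℂ).smulRight (K (b i)))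

variable [CompleteSpace E]

/-- An operator into `L²` given by square-integrable pairings is compact. -/
theorem isCompactOperator_of_inner_kernel {α : Type*} {m : MeasurableSpace α} {μ : Measure α}
    (K : E →L[ℂ] Lp ℂ 2 μ) (v : α → E) (w : α → ℝ) (hw : Integrable (fun x => w x ^ 2) μ)
    (hvw : ∀ x, ‖v x‖ ≤ w x) (hK : ∀ f, ∀ᵐ x ∂μ, K f x = inner ℂ (v x) f) :
    IsCompactOperator K := by
  obtain ⟨s, b, -⟩ := exists_hilbertBasis ℂ E
  refine isCompactOperator_of_summable_norm_sq b K ?_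
  -- Bessel's inequality for the vector `v x`, at almost every `x`, integrates to a bound for every
  -- finite partial sum.
  refine summable_of_sum_le (c := ∫ x, w x ^ 2 ∂μ) (fun i => by positivity) fun t => ?_
  have h1 : ∀ g : Lp ℂ 2 μ, ‖g‖ ^ 2 = ∫ x, ‖g x‖ ^ 2 ∂μ := fun g => by
    rw [← inner_self_eq_norm_sq (𝕜 := ℂ), L2.inner_def, ← integral_re (L2.integrable_inner g g)]
    simp [inner_self_eq_norm_sq_to_K, ← Complex.ofReal_pow]
  have h2 : ∀ g : Lp ℂ 2 μ, Integrable (fun x => ‖g x‖ ^ 2) μ := fun g =>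
    (memLp_two_iff_integrable_sq_norm (Lp.aestronglyMeasurable g)).1 (Lp.memLp g)
  simp_rw [h1]
  rw [← integral_finsetSum _ fun i _ => h2 _]
  refine integral_mono_ae (integrable_finsetSum _ fun i _ => h2 _) hw ?_
  have h3 : ∀ᵐ x ∂μ, ∀ i ∈ t, K (b i) x = inner ℂ (v x) (b i) :=
    (Finset.eventually_all t).2 fun i _ => hK (b i)
  filter_upwards [h3] with x hx
  calc ∑ i ∈ t, ‖K (b i) x‖ ^ 2 = ∑ i ∈ t, ‖inner ℂ (b i) (v x)‖ ^ 2 :=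
        Finset.sum_congr rfl fun i hi => by rw [hx i hi, norm_inner_symm]
    _ ≤ ‖v x‖ ^ 2 := b.orthonormal.sum_inner_products_le _
    _ ≤ w x ^ 2 := by gcongr; exact hvw x

/-- A self-adjoint operator which is bounded below is invertible. -/
theorem isUnit_of_isSymmetric_of_le_norm {B : E →L[ℂ] E} (hB : (B : E →ₗ[ℂ] E).IsSymmetric)
    {ε : ℝ} (hε : 0 < ε) (h : ∀ x, ε * ‖x‖ ≤ ‖B x‖) : IsUnit B := by
  -- The square is coercive, since `⟪B² x, x⟫ = ‖B x‖²`, and commuting factors of a unit are units.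
  have h1 : IsUnit (B * B) := by
    refine ContinuousLinearMap.isUnit_of_forall_le_norm_inner_map (B * B)
      (c := ⟨ε ^ 2, by positivity⟩) (by exact pow_pos hε 2) fun x => ?_
    have h2 : inner ℂ ((B * B) x) x = inner ℂ (B x) (B x) := hB (B x) x
    have h3 : ‖inner ℂ (B x) (B x)‖ = ‖B x‖ ^ 2 := by
      rw [inner_self_eq_norm_sq_to_K, norm_pow]
      simp
    rw [h2, h3, mul_comm]
    change ε ^ 2 * ‖x‖ ^ 2 ≤ _
    rw [← mul_pow]
    exact pow_le_pow_left₀ (by positivity) (h x) 2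
  exact ((Commute.refl B).isUnit_mul_iff.1 h1).1

/-- If `A (1 - A)` is compact and `A` is self-adjoint, then the eigenvectors
of `A` span a dense subspace. -/
theorem orthogonal_iSup_eigenspace_eq_bot {A : E →L[ℂ] E} (hA : (A : E →ₗ[ℂ] E).IsSymmetric)
    (hK : IsCompactOperator ((A * (1 - A) : E →L[ℂ] E) : E → E)) :
    (⨆ μ, Module.End.eigenspace (A : Module.End ℂ E) μ)ᗮ = ⊥ := by
  have hKs : ((A * (1 - A) : E →L[ℂ] E) : E →ₗ[ℂ] E).IsSymmetric := fun x y => by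
    have h := hA
    simp only [LinearMap.IsSymmetric, ContinuousLinearMap.coe_coe] at h
    simp [inner_sub_left, inner_sub_right, h]
  refine eq_bot_iff.2 ((Submodule.orthogonal_le ?_).trans_eq
    (ContinuousLinearMap.orthogonalComplement_iSup_eigenspaces_eq_bot hK hKs))
  refine iSup_le fun μ x hx => ?_
  have hx' : A x - A (A x) = μ • x := by simpa using Module.End.mem_eigenspace_iff.1 hx
  -- On the `μ`-eigenspace of `A (1 - A)` the operator `A` is annihilated by `t² - t + μ`, whose
  -- roots are `r` and `s`.
  obtain ⟨d, hd⟩ := IsAlgClosed.exists_pow_nat_eq (1 - 4 * μ) (n := 2) (by norm_num)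
  set r : ℂ := (1 + d) / 2
  set s : ℂ := (1 - d) / 2
  have hrs : r + s = 1 := by simp only [r, s]; ring
  have hrs' : r * s = μ := by
    simp only [r, s]; linear_combination -hd / 4
  have hmem : ∀ a b : ℂ, a + b = 1 → a * b = μ →
      A x - a • x ∈ Module.End.eigenspace (A : Module.End ℂ E) b := by
    intro a b hab hab'
    rw [Module.End.mem_eigenspace_iff]
    have h2 : A (A x) = A x - μ • x := by rw [← hx']; abel
    simp only [ContinuousLinearMap.coe_coe, map_sub, map_smul, h2, ← hab', smul_sub, smul_smul]
    have : b = 1 - a := by rw [← hab]; ring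
    subst this
    module
  -- For a double root, symmetry turns `(A - 1/2)² x = 0` into `(A - 1/2) x = 0`. For distinct
  -- roots, `x` is a combination of two eigenvectors.
  by_cases hd0 : d = 0
  · have hr : r = 1 / 2 := by simp [r, hd0]
    have hs : s = 1 / 2 := by simp [s, hd0]
    have h3 := Module.End.mem_eigenspace_iff.1 (hmem r s hrs hrs')
    rw [hr, hs] at h3
    have h4 : A x - (1 / 2 : ℂ) • x = 0 := by
      rw [← inner_self_eq_zero (𝕜 := ℂ)]
      set y := A x - (1 / 2 : ℂ) • x
      have : inner ℂ y y = inner ℂ x (A y - (1 / 2 : ℂ) • y) := by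
        have h6 : inner ℂ (A x) y = inner ℂ x (A y) := hA x y
        change inner ℂ (A x - (1 / 2 : ℂ) • x) y = _
        rw [inner_sub_left, h6, inner_smul_left, inner_sub_right x (A y), inner_smul_right x y,
          Complex.conj_eq_iff_im.2 (by norm_num)]
      rw [this]
      have h5 : A y = (1 / 2 : ℂ) • y := h3
      simp [h5]
    refine Submodule.mem_iSup_of_mem (1 / 2 : ℂ) (Module.End.mem_eigenspace_iff.2 ?_)
    exact sub_eq_zero.1 h4
  · have h5 : x = d⁻¹ • ((A x - s • x) - (A x - r • x)) := by
      have : r - s = d := by simp only [r, s]; ring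
      rw [sub_sub_sub_cancel_left, ← sub_smul, this, smul_smul, inv_mul_cancel₀ hd0, one_smul]
    rw [h5]
    refine Submodule.smul_mem _ _ (Submodule.sub_mem _ ?_ ?_)
    · exact Submodule.mem_iSup_of_mem r (hmem s r (by rw [← hrs]; ring) (by rw [← hrs']; ring))
    · exact Submodule.mem_iSup_of_mem s (hmem r s hrs hrs')

/-- A non-invertible shift of a self-adjoint operator with dense eigenvectors has eigenvalues
arbitrarily close to the shift. -/
theorem exists_hasEigenvalue_near {A : E →L[ℂ] E} (hA : (A : E →ₗ[ℂ] E).IsSymmetric)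
    (hd : (⨆ μ, Module.End.eigenspace (A : Module.End ℂ E) μ)ᗮ = ⊥) (c : ℝ)
    (hc : ¬ IsUnit (A - (c : ℂ) • (1 : E →L[ℂ] E))) {ε : ℝ} (hε : 0 < ε) :
    ∃ l : ℝ, |l - c| < ε ∧ Module.End.HasEigenvalue (A : Module.End ℂ E) (l : ℂ) := by
  by_contra! hcon
  refine hc ?_
  set B := A - (c : ℂ) • (1 : E →L[ℂ] E) with hBdef
  have hBs : (B : E →ₗ[ℂ] E).IsSymmetric := fun x y => by
    have h := hA x y
    simp only [ContinuousLinearMap.coe_coe] at h ⊢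
    simp only [hBdef, sub_apply, smul_apply,
      one_apply_eq_self, inner_sub_left, inner_sub_right, h, inner_smul_left,
      inner_smul_right, Complex.conj_ofReal]
  refine isUnit_of_isSymmetric_of_le_norm hBs hε ?_
  have hdense :
      Dense ((⨆ μ, Module.End.eigenspace (A : Module.End ℂ E) μ : Submodule ℂ E) : Set E) :=
    Submodule.dense_iff_topologicalClosure_eq_top.2
      ((Submodule.topologicalClosure_eq_top_iff).2 hd)
  have hclosed : IsClosed {x : E | ε * ‖x‖ ≤ ‖B x‖} :=
    isClosed_le (by fun_prop) (by fun_prop)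
  intro x
  refine hclosed.closure_subset_iff.2 ?_ (hdense x)
  intro x hx
  obtain ⟨f, hf, rfl⟩ := (Submodule.mem_iSup_iff_exists_finsupp _ x).1 hx
  -- Pythagoras across the orthogonal eigenspaces reduces the lower bound to each eigenvalue, which
  -- is real and at distance at least `ε` from `c`.
  have hsum := hA.orthogonalFamily_eigenspaces.norm_sum (fun μ => ⟨f μ, hf μ⟩) f.support
  have hsumB := hA.orthogonalFamily_eigenspaces.norm_sum
    (fun μ => ⟨(μ - c) • f μ, Submodule.smul_mem _ _ (hf μ)⟩) f.support
  have hBf : ∀ μ, B (f μ) = (μ - c) • f μ := fun μ => by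
    have := Module.End.mem_eigenspace_iff.1 (hf μ)
    simp only [ContinuousLinearMap.coe_coe] at this
    simp [hBdef, this, sub_smul]
  simp only [Submodule.coe_subtypeₗᵢ, Submodule.coe_subtype, Submodule.coe_norm] at hsum hsumB
  simp only [Set.mem_ofPred_eq, Finsupp.sum, map_sum, hBf]
  refine le_of_sq_le_sq ?_ (norm_nonneg _)
  rw [mul_pow, hsum, hsumB, Finset.mul_sum]
  refine Finset.sum_le_sum fun μ hμ => ?_
  have hev : Module.End.HasEigenvalue (A : Module.End ℂ E) μ :=
    Module.End.hasEigenvalue_of_hasEigenvector ⟨hf μ, Finsupp.mem_support_iff.1 hμ⟩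
  have hre : ((μ.re : ℝ) : ℂ) = μ := Complex.conj_eq_iff_re.1 (hA.conj_eigenvalue_eq_self hev)
  have h1 : ε ≤ ‖μ - c‖ := by
    by_contra! hlt
    refine hcon μ.re ?_ (hre ▸ hev)
    rw [← hre, ← Complex.ofReal_sub, Complex.norm_real] at hlt
    exact hlt
  rw [norm_smul, mul_pow]
  gcongr

end Hilbert

/-! ### Cauchy kernels in `L²(ℝ)` -/

/-- The Hilbert space `L²(ℝ)` of complex-valued functions. -/
abbrev L2Line : Type := Lp ℂ 2 (volume : Measure ℝ)

theorem integrable_mul_of_memLp_two {α : Type*} {m : MeasurableSpace α} {μ : Measure α}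
    {f g : α → ℂ} (hf : MemLp f 2 μ) (hg : MemLp g 2 μ) : Integrable (fun y => f y * g y) μ :=
  hf.integrable_mul hg

theorem integrable_inv_sq_add_sq (a : ℝ) {b : ℝ} (hb : b ≠ 0) :
    Integrable fun y : ℝ => ((y - a) ^ 2 + b ^ 2)⁻¹ := by
  have h := ((integrable_inv_one_add_sq.comp_div hb).comp_sub_right a).const_mul ((b ^ 2)⁻¹)
  refine h.congr (Eventually.of_forall fun y => ?_)
  simp only
  rw [← mul_inv]
  congr 1
  field_simp
  ring

theorem ofReal_sub_ne_zero (y : ℝ) {z : ℂ} (hz : z.im ≠ 0) : (y : ℂ) - z ≠ 0 := fun h =>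
  hz (by simpa using congrArg Complex.im h)

theorem norm_inv_ofReal_sub_sq (y : ℝ) (z : ℂ) :
    ‖((y : ℂ) - z)⁻¹‖ ^ 2 = ((y - z.re) ^ 2 + z.im ^ 2)⁻¹ := by
  rw [norm_inv, inv_pow, ← Complex.normSq_eq_norm_sq, Complex.normSq_apply]
  simp
  ring

theorem continuous_inv_ofReal_sub {z : ℂ} (hz : z.im ≠ 0) :
    Continuous fun y : ℝ => ((y : ℂ) - z)⁻¹ :=
  (by fun_prop : Continuous fun y : ℝ => (y : ℂ) - z).inv₀ fun y => ofReal_sub_ne_zero y hz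

theorem memLp_inv_ofReal_sub {z : ℂ} (hz : z.im ≠ 0) :
    MemLp (fun y : ℝ => ((y : ℂ) - z)⁻¹) 2 volume := by
  rw [memLp_two_iff_integrable_sq_norm (continuous_inv_ofReal_sub hz).aestronglyMeasurable]
  simpa only [norm_inv_ofReal_sub_sq] using integrable_inv_sq_add_sq z.re hz

/-- The Cauchy kernel `y ↦ 1 / (y - z)` as an element of `L²(ℝ)`. -/
noncomputable def cauchyKernel (z : ℂ) (hz : z.im ≠ 0) : L2Line :=
  (memLp_inv_ofReal_sub hz).toLp _

theorem inner_cauchyKernel (z : ℂ) (hz : z.im ≠ 0) (f : L2Line) :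
    inner ℂ (cauchyKernel z hz) f = ∫ y : ℝ, f y / ((y : ℂ) - starRingEnd ℂ z) := by
  rw [L2.inner_def]
  refine integral_congr_ae ?_
  filter_upwards [(memLp_inv_ofReal_sub hz).coeFn_toLp] with y hy
  simp [cauchyKernel, hy, RCLike.inner_apply, div_eq_mul_inv]

theorem tendsto_inv_ofReal_sub (z : ℂ) {l : Filter ℝ} (hl : Tendsto (fun y : ℝ => |y|) l atTop) :
    Tendsto (fun y : ℝ => ((y : ℂ) - z)⁻¹) l (𝓝 0) := by
  refine tendsto_inv₀_cobounded.comp ?_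
  rw [← tendsto_norm_atTop_iff_cobounded]
  refine tendsto_atTop_mono (fun y => ?_) (tendsto_atTop_add_const_right _ (-‖z‖) hl)
  have := norm_sub_norm_le (y : ℂ) z
  simpa [sub_eq_add_neg] using this

/-- If the quotient were a real `q ≤ 0`, imaginary parts in `y - w = q (y - z)` would have
incompatible signs. Hence the principal logarithm is differentiable along the whole line. -/
theorem div_ofReal_sub_mem_slitPlane (y : ℝ) {w z : ℂ} (hw : 0 < w.im) (hz : 0 < z.im) :
    ((y : ℂ) - w) / ((y : ℂ) - z) ∈ Complex.slitPlane := by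
  by_contra h
  rw [Complex.mem_slitPlane_iff] at h
  push Not at h
  obtain ⟨h1, h2⟩ := h
  set q := ((y : ℂ) - w) / ((y : ℂ) - z)
  have hq : (y : ℂ) - w = q * ((y : ℂ) - z) :=
    (div_mul_cancel₀ _ (ofReal_sub_ne_zero y hz.ne')).symm
  have := congrArg Complex.im hq
  simp [h2] at this
  nlinarith

/-- The integrand has the primitive `(w - z)⁻¹ log ((y - w) / (y - z))`, or `-(y - w)⁻¹` when `w =
z`, which tends to `0` at both ends. -/
theorem integral_inv_mul_inv_eq_zero {w z : ℂ} (hw : 0 < w.im) (hz : 0 < z.im) :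
    ∫ y : ℝ, ((y : ℂ) - w)⁻¹ * ((y : ℂ) - z)⁻¹ = 0 := by
  have hint : Integrable fun y : ℝ => ((y : ℂ) - w)⁻¹ * ((y : ℂ) - z)⁻¹ :=
    integrable_mul_of_memLp_two (memLp_inv_ofReal_sub hw.ne') (memLp_inv_ofReal_sub hz.ne')
  have hd : ∀ (v : ℂ) (y : ℝ), HasDerivAt (fun y : ℝ => (y : ℂ) - v) 1 y := fun v y =>
    (HasDerivAt.ofReal_comp (hasDerivAt_id y)).sub_const v |>.congr_deriv (by simp)
  have htop := tendsto_abs_atTop_atTop (G := ℝ)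
  have hbot := tendsto_abs_atBot_atTop (G := ℝ)
  by_cases hwz : w = z
  · subst hwz
    have := integral_of_hasDerivAt_of_tendsto (f := fun y : ℝ => -((y : ℂ) - w)⁻¹)
      (fun y => ((hd w y).inv (ofReal_sub_ne_zero y hw.ne')).neg.congr_deriv (by
        have := ofReal_sub_ne_zero y hw.ne'
        field_simp)) hint
      (tendsto_inv_ofReal_sub w hbot).neg (tendsto_inv_ofReal_sub w htop).neg
    simpa using this
  · have hwz' : w - z ≠ 0 := sub_ne_zero.2 hwz
    have hlim : ∀ l : Filter ℝ, Tendsto (fun y : ℝ => |y|) l atTop →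
        Tendsto (fun y : ℝ => (w - z)⁻¹ * Complex.log (((y : ℂ) - w) / ((y : ℂ) - z))) l (𝓝 0) := by
      intro l hl
      have h1 : Tendsto (fun y : ℝ => 1 - (w - z) * ((y : ℂ) - z)⁻¹) l (𝓝 (1 - (w - z) * 0)) :=
        ((tendsto_inv_ofReal_sub z hl).const_mul _).const_sub _
      have h2 : Tendsto (fun y : ℝ => ((y : ℂ) - w) / ((y : ℂ) - z)) l (𝓝 1) := by
        have h3 : (1 : ℂ) - (w - z) * 0 = 1 := by ring
        rw [h3] at h1
        refine h1.congr fun y => ?_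
        have := ofReal_sub_ne_zero y hz.ne'
        field_simp
        ring
      have h4 := (h2.clog (by simp)).const_mul ((w - z)⁻¹)
      simpa using h4
    have := integral_of_hasDerivAt_of_tendsto
      (f := fun y : ℝ => (w - z)⁻¹ * Complex.log (((y : ℂ) - w) / ((y : ℂ) - z)))
      (fun y => ((((hd w y).div (hd z y) (ofReal_sub_ne_zero y hz.ne')).clog_real
        (div_ofReal_sub_mem_slitPlane y hw hz)).const_mul ((w - z)⁻¹)).congr_deriv (by
          have h1 := ofReal_sub_ne_zero y hw.ne'
          have h2 := ofReal_sub_ne_zero y hz.ne'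
          rw [Pi.div_apply]
          field_simp
          ring)) hint (hlim _ hbot) (hlim _ htop)
    simpa using this

theorem inner_cauchyKernel_eq_zero {w z : ℂ} (hw : w.im < 0) (hz : 0 < z.im) :
    inner ℂ (cauchyKernel z hz.ne') (cauchyKernel w hw.ne) = 0 := by
  rw [← inner_conj_symm, inner_cauchyKernel]
  rw [map_eq_zero, ← integral_inv_mul_inv_eq_zero (w := starRingEnd ℂ w) (by simpa using hw) hz]
  refine integral_congr_ae ?_
  filter_upwards [(memLp_inv_ofReal_sub hz.ne').coeFn_toLp] with y hy
  simp [cauchyKernel, hy, div_eq_mul_inv, mul_comm]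

/-! ### The Hardy space and the Hilbert transform on the line -/

/-- The Hardy space of the lower half plane: the closed span of the Cauchy kernels with pole in the
upper half plane. -/
noncomputable def hardySubspace : Submodule ℂ L2Line :=
  (Submodule.span ℂ {c | ∃ (z : ℂ) (hz : 0 < z.im), c = cauchyKernel z hz.ne'}).topologicalClosure

instance : CompleteSpace hardySubspace :=
  (Submodule.isClosed_topologicalClosure _).completeSpace_coe

/-- The Hilbert transform on `L²(ℝ)`, with the sign convention
`(1 / π) p.v. ∫ f(y) / (y - x) dy`. -/
noncomputable def hilbertLine : L2Line →L[ℂ] L2Line :=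
  (-Complex.I) • (hardySubspace.reflection.toContinuousLinearEquiv : L2Line →L[ℂ] L2Line)

theorem hilbertLine_apply (f : L2Line) : hilbertLine f = -Complex.I • hardySubspace.reflection f :=
  rfl

theorem hilbertLine_hilbertLine (f : L2Line) : hilbertLine (hilbertLine f) = -f := by
  simp [hilbertLine_apply, smul_smul]

theorem inner_hilbertLine_left (f g : L2Line) :
    inner ℂ (hilbertLine f) g = -inner ℂ f (hilbertLine g) := by
  have h : inner ℂ (hardySubspace.reflection f) g = inner ℂ f (hardySubspace.reflection g) := by
    rw [← LinearIsometryEquiv.inner_map_map hardySubspace.reflection f,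
      Submodule.reflection_reflection]
  rw [hilbertLine_apply, hilbertLine_apply, inner_smul_left, inner_smul_right, h]
  simp

theorem hilbertLine_cauchyKernel_of_pos {z : ℂ} (hz : 0 < z.im) :
    hilbertLine (cauchyKernel z hz.ne') = -Complex.I • cauchyKernel z hz.ne' := by
  rw [hilbertLine_apply, Submodule.reflection_mem_subspace_eq_self]
  exact Submodule.le_topologicalClosure _ (Submodule.subset_span ⟨z, hz, rfl⟩)

theorem hilbertLine_cauchyKernel_of_neg {z : ℂ} (hz : z.im < 0) :
    hilbertLine (cauchyKernel z hz.ne) = Complex.I • cauchyKernel z hz.ne := by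
  rw [hilbertLine_apply, Submodule.reflection_mem_subspace_orthogonalComplement_eq_neg]
  · simp
  · rw [hardySubspace, Submodule.orthogonal_closure, Submodule.mem_orthogonal]
    intro u hu
    induction hu using Submodule.span_induction with
    | mem x hx =>
      obtain ⟨w, hw, rfl⟩ := hx
      exact inner_cauchyKernel_eq_zero hz hw
    | zero => simp
    | add x y _ _ hx hy => rw [inner_add_left, hx, hy, add_zero]
    | smul a x _ hx => rw [inner_smul_left, hx, mul_zero]

/-- The Poisson integral of `Hf` is the conjugate Poisson integral of `f`. -/
theorem integral_poisson_hilbertLine (f : L2Line) (x : ℝ) {ε : ℝ} (hε : 0 < ε) :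
    ∫ y : ℝ, ((ε / ((y - x) ^ 2 + ε ^ 2) : ℝ) : ℂ) * hilbertLine f y =
      ∫ y : ℝ, (((y - x) / ((y - x) ^ 2 + ε ^ 2) : ℝ) : ℂ) * f y := by
  -- The Poisson and conjugate Poisson kernels are the imaginary and real parts of `1 / (y - w)`.
  -- Skew-adjointness moves `H` onto the Cauchy kernels, where it acts as `±i`.
  set w : ℂ := x + ε * Complex.I with hw
  have hwim : w.im = ε := by simp [w]
  have hwre : w.re = x := by simp [w]
  have hw0 : 0 < w.im := hwim ▸ hε
  have hw1 : (starRingEnd ℂ w).im < 0 := by simpa using hw0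
  have hint : ∀ (g : L2Line) (z : ℂ), z.im ≠ 0 → Integrable fun y : ℝ => g y / ((y : ℂ) - z) :=
    fun g z hz => by
      simp only [div_eq_mul_inv]
      exact integrable_mul_of_memLp_two (Lp.memLp g) (memLp_inv_ofReal_sub hz)
  have hup : ∫ y : ℝ, hilbertLine f y / ((y : ℂ) - w) =
      Complex.I * ∫ y : ℝ, f y / ((y : ℂ) - w) := by
    have h := inner_hilbertLine_left (cauchyKernel _ hw1.ne) f
    rw [hilbertLine_cauchyKernel_of_neg hw1, inner_smul_left, inner_cauchyKernel,
      inner_cauchyKernel, Complex.conj_conj, Complex.conj_I] at h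
    linear_combination h
  have hdown : ∫ y : ℝ, hilbertLine f y / ((y : ℂ) - starRingEnd ℂ w) =
      -Complex.I * ∫ y : ℝ, f y / ((y : ℂ) - starRingEnd ℂ w) := by
    have h := inner_hilbertLine_left (cauchyKernel _ hw0.ne') f
    rw [hilbertLine_cauchyKernel_of_pos hw0, inner_smul_left, inner_cauchyKernel,
      inner_cauchyKernel, map_neg, Complex.conj_I] at h
    linear_combination h
  have hden : ∀ y : ℝ, ((y : ℂ) - w) * ((y : ℂ) - starRingEnd ℂ w) = ((y - x) ^ 2 + ε ^ 2 : ℝ) := by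
    intro y
    simp only [hw, map_add, map_mul, Complex.conj_ofReal, Complex.conj_I]
    push_cast
    linear_combination (-(ε : ℂ) ^ 2) * Complex.I_sq
  have hden0 : ∀ y : ℝ, (((y - x) ^ 2 + ε ^ 2 : ℝ) : ℂ) ≠ 0 := fun y => by
    have : 0 < (y - x) ^ 2 + ε ^ 2 := by positivity
    exact_mod_cast this.ne'
  have hsub : w - starRingEnd ℂ w = 2 * ε * Complex.I := by
    simp only [hw, map_add, map_mul, Complex.conj_ofReal, Complex.conj_I]; ring
  have hadd : w + starRingEnd ℂ w = 2 * x := by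
    simp only [hw, map_add, map_mul, Complex.conj_ofReal, Complex.conj_I]; ring
  have hP : ∀ (g : L2Line) (y : ℝ), ((ε / ((y - x) ^ 2 + ε ^ 2) : ℝ) : ℂ) * g y =
      (2 * Complex.I)⁻¹ * (g y / ((y : ℂ) - w) - g y / ((y : ℂ) - starRingEnd ℂ w)) := by
    intro g y
    rw [div_sub_div _ _ (ofReal_sub_ne_zero y hw0.ne') (ofReal_sub_ne_zero y hw1.ne), hden,
      Complex.ofReal_div, div_mul_eq_mul_div, mul_div_assoc', div_left_inj' (hden0 y)]
    have : g y * ((y : ℂ) - starRingEnd ℂ w) - ((y : ℂ) - w) * g y = 2 * Complex.I * (ε * g y) := by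
      linear_combination g y * hsub
    rw [this, inv_mul_cancel_left₀ (by simp)]
  have hQ : ∀ (g : L2Line) (y : ℝ), (((y - x) / ((y - x) ^ 2 + ε ^ 2) : ℝ) : ℂ) * g y =
      2⁻¹ * (g y / ((y : ℂ) - w) + g y / ((y : ℂ) - starRingEnd ℂ w)) := by
    intro g y
    rw [div_add_div _ _ (ofReal_sub_ne_zero y hw0.ne') (ofReal_sub_ne_zero y hw1.ne), hden,
      Complex.ofReal_div, div_mul_eq_mul_div, mul_div_assoc', div_left_inj' (hden0 y)]
    push_cast
    linear_combination (2⁻¹ * g y) * hadd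
  simp_rw [hP, hQ]
  rw [integral_const_mul, integral_const_mul, integral_sub (hint _ _ hw0.ne') (hint _ _ hw1.ne),
    integral_add (hint _ _ hw0.ne') (hint _ _ hw1.ne), hup, hdown]
  have := Complex.I_ne_zero
  field_simp
  ring

/-! ### Poisson integrals at Lebesgue points -/

/-- A measure growing at most linearly around `x` has bounded Poisson integrals at `x`. -/
theorem lintegral_poisson_le_of_measure_closedBall_le {ν : Measure ℝ} {x C : ℝ} (hC : 0 ≤ C)
    (hν : ∀ r > 0, ν (Metric.closedBall x r) ≤ ENNReal.ofReal (C * r)) {ε : ℝ} (hε : 0 < ε) :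
    ∫⁻ y, ENNReal.ofReal (ε / ((y - x) ^ 2 + ε ^ 2)) ∂ν ≤ ENNReal.ofReal (2 * C) := by
  have hcont : Continuous fun y : ℝ => ε / ((y - x) ^ 2 + ε ^ 2) :=
    continuous_const.div (by fun_prop) fun y => by positivity
  -- Layer cake: the superlevel set at height `t` is empty for `t > 1 / ε` and otherwise lies in the
  -- ball of radius `√(ε / t)`; the integral of this radius over `(0, 1 / ε)` is `2`.
  rw [lintegral_eq_lintegral_meas_lt ν (Eventually.of_forall fun y => by positivity)
    hcont.measurable.aemeasurable]
  have hle : ∀ t ∈ Set.Ioi (0 : ℝ), ν {y | t < ε / ((y - x) ^ 2 + ε ^ 2)} ≤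
      (Set.Ioc 0 (1 / ε)).indicator
        (fun t => ENNReal.ofReal (C * (√ε * t ^ (-(1 / 2) : ℝ)))) t := by
    intro t ht
    have ht : 0 < t := ht
    have hkey : ∀ y, t < ε / ((y - x) ^ 2 + ε ^ 2) → t * (y - x) ^ 2 + t * ε ^ 2 < ε := by
      intro y hy
      rw [lt_div_iff₀ (by positivity)] at hy
      linarith
    by_cases hte : t ≤ 1 / ε
    · rw [Set.indicator_of_mem (show t ∈ Set.Ioc 0 (1 / ε) from ⟨ht, hte⟩)]
      refine (measure_mono fun y hy => ?_).trans (hν _ (by positivity))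
      have h1 := hkey y hy
      rw [Metric.mem_closedBall, Real.dist_eq]
      refine abs_le_of_sq_le_sq ?_ (by positivity)
      have h2 : (t ^ (-(1 / 2) : ℝ)) ^ 2 = t⁻¹ := by
        rw [← Real.rpow_natCast, ← Real.rpow_mul ht.le, ← Real.rpow_neg_one]
        norm_num
      rw [mul_pow, Real.sq_sqrt hε.le, h2, ← div_eq_mul_inv, le_div_iff₀ ht]
      nlinarith [sq_nonneg ε]
    · have : {y | t < ε / ((y - x) ^ 2 + ε ^ 2)} = ∅ := by
        refine Set.eq_empty_of_forall_notMem fun y hy => hte ?_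
        have h1 := hkey y hy
        rw [le_div_iff₀ hε]
        have : t * ε ^ 2 ≤ 1 * ε := by nlinarith [mul_nonneg ht.le (sq_nonneg (y - x))]
        nlinarith
      simp [this]
  refine (setLIntegral_mono' measurableSet_Ioi hle).trans ?_
  refine (setLIntegral_le_lintegral _ _).trans ?_
  rw [lintegral_indicator measurableSet_Ioc]
  have hint : IntegrableOn (fun t : ℝ => C * (√ε * t ^ (-(1 / 2) : ℝ))) (Set.Ioc 0 (1 / ε)) := by
    have := (intervalIntegral.intervalIntegrable_rpow' (a := 0) (b := 1 / ε)
      (r := -(1 / 2)) (by norm_num))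
    rw [intervalIntegrable_iff_integrableOn_Ioc_of_le (by positivity)] at this
    exact (this.const_mul _).const_mul _
  rw [← ofReal_integral_eq_lintegral_ofReal hint]
  · refine ENNReal.ofReal_le_ofReal (le_of_eq ?_)
    rw [integral_const_mul, integral_const_mul, ← intervalIntegral.integral_of_le (by positivity),
      integral_rpow (Or.inl (by norm_num))]
    have h1 : (-(1 / 2) + 1 : ℝ) = 1 / 2 := by norm_num
    rw [h1, ← Real.sqrt_eq_rpow, ← Real.sqrt_eq_rpow, Real.sqrt_zero, Real.sqrt_div zero_le_one,
      Real.sqrt_one]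
    have : √ε ≠ 0 := (Real.sqrt_pos.2 hε).ne'
    field_simp
    ring
  · exact (ae_restrict_iff' measurableSet_Ioc).2 (Eventually.of_forall fun t ht => by
      have := ht.1
      positivity)

theorem memLp_inv_sq_add_sq (x : ℝ) {δ : ℝ} (hδ : δ ≠ 0) :
    MemLp (fun y : ℝ => (((y - x) ^ 2 + δ ^ 2)⁻¹ : ℝ)) 2 volume := by
  have hcont : Continuous fun y : ℝ => ((y - x) ^ 2 + δ ^ 2)⁻¹ :=
    (by fun_prop : Continuous fun y : ℝ => (y - x) ^ 2 + δ ^ 2).inv₀ fun y => by positivity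
  rw [memLp_two_iff_integrable_sq_norm hcont.aestronglyMeasurable]
  refine ((integrable_inv_sq_add_sq x hδ).const_mul ((δ ^ 2)⁻¹)).mono'
    (hcont.norm.pow 2).aestronglyMeasurable (Eventually.of_forall fun y => ?_)
  have h1 : 0 < (y - x) ^ 2 + δ ^ 2 := by positivity
  rw [norm_pow, norm_norm, Real.norm_of_nonneg (by positivity), sq]
  gcongr
  nlinarith [sq_nonneg (y - x)]

/-- Poisson integrals of `|g - g x|` vanish in the limit at a Lebesgue point `x` of `g`. -/
theorem tendsto_lintegral_poisson {g : ℝ → ℂ} (hg : MemLp g 2 volume) {x : ℝ}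
    (hx : Tendsto (fun r => ⨍ y in Metric.closedBall x r, ‖g y - g x‖) (𝓝[>] 0) (𝓝 0)) :
    Tendsto (fun ε : ℝ => ∫⁻ y, ‖g y - g x‖ₑ * ENNReal.ofReal (ε / ((y - x) ^ 2 + ε ^ 2)))
      (𝓝[>] 0) (𝓝 0) := by
  have hm : AEMeasurable (fun y => ‖g y - g x‖ₑ) :=
    (hg.1.sub aestronglyMeasurable_const).enorm
  have hP : ∀ ε : ℝ, Measurable fun y : ℝ => ENNReal.ofReal (ε / ((y - x) ^ 2 + ε ^ 2)) :=
    fun ε => by fun_prop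
  rw [ENNReal.tendsto_nhds_zero]
  intro κ hκ
  obtain ⟨C, hC, hCκ⟩ : ∃ C : ℝ, 0 < C ∧ ENNReal.ofReal (2 * C) ≤ κ / 2 := by
    obtain ⟨c, hc, hc'⟩ := ENNReal.lt_iff_exists_real_btwn.1 (ENNReal.half_pos hκ.ne')
    refine ⟨c / 2, half_pos (ENNReal.ofReal_pos.1 hc'.1), ?_⟩
    rw [mul_div_cancel₀ _ two_ne_zero]
    exact hc'.2.le
  obtain ⟨δ, hδ, hδC⟩ : ∃ δ > 0, ∀ r, 0 < r → r ≤ δ →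
      ⨍ y in Metric.closedBall x r, ‖g y - g x‖ ≤ C / 2 := by
    have := (hx.eventually (gt_mem_nhds (half_pos hC)))
    rw [eventually_nhdsWithin_iff, Metric.eventually_nhds_iff] at this
    obtain ⟨δ, hδ, h⟩ := this
    refine ⟨δ / 2, half_pos hδ, fun r hr hrδ => (h ?_ hr).le⟩
    rw [Real.dist_eq, sub_zero, abs_of_pos hr]
    linarith
  have hloc : LocallyIntegrable (fun y => g y - g x) volume :=
    (hg.locallyIntegrable one_le_two).sub (locallyIntegrable_const _)
  have hball : ∀ r, 0 < r → r ≤ δ →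
      ∫⁻ y in Metric.closedBall x r, ‖g y - g x‖ₑ ≤ ENNReal.ofReal (C * r) := by
    intro r hr hrδ
    rw [← ofReal_integral_norm_eq_lintegral_enorm
      (hloc.integrableOn_isCompact (isCompact_closedBall x r))]
    refine ENNReal.ofReal_le_ofReal ?_
    have := hδC r hr hrδ
    rw [setAverage_eq, Measure.real, Real.volume_closedBall, ENNReal.toReal_ofReal (by positivity),
      smul_eq_mul, inv_mul_le_iff₀ (by positivity)] at this
    linarith
  -- The measure with density `‖g y - g x‖` on the `δ`-ball has mass at most `C r` on every ball of
  -- radius `r`, by the choice of `δ`.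
  have hnear : ∀ ε > 0, ∫⁻ y in Metric.closedBall x δ,
      ‖g y - g x‖ₑ * ENNReal.ofReal (ε / ((y - x) ^ 2 + ε ^ 2)) ≤ κ / 2 := by
    intro ε hε
    refine le_trans (le_of_eq ?_) ((lintegral_poisson_le_of_measure_closedBall_le
      (ν := (volume.restrict (Metric.closedBall x δ)).withDensity fun y => ‖g y - g x‖ₑ) (x := x)
      hC.le (fun r hr => ?_) hε).trans hCκ)
    · rw [lintegral_withDensity_eq_lintegral_mul₀ hm.restrict (hP ε).aemeasurable]
      rfl
    · rw [withDensity_apply _ Metric.isClosed_closedBall.measurableSet,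
        Measure.restrict_restrict Metric.isClosed_closedBall.measurableSet]
      rcases le_total r δ with h | h
      · exact (lintegral_mono_set Set.inter_subset_left).trans (hball r hr h)
      · refine (lintegral_mono_set Set.inter_subset_right).trans ((hball δ hδ le_rfl).trans ?_)
        exact ENNReal.ofReal_le_ofReal (by gcongr)
  set M : ENNReal := ∫⁻ y, ‖g y - g x‖ₑ * ENNReal.ofReal (((y - x) ^ 2 + δ ^ 2)⁻¹)
  have hM : M ≠ ⊤ := by
    have h1 : Integrable (fun y => (g y - g x) * ((((y - x) ^ 2 + δ ^ 2)⁻¹ : ℝ) : ℂ)) := by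
      simp_rw [sub_mul]
      exact (hg.integrable_mul (memLp_inv_sq_add_sq x hδ.ne').ofReal).sub
        ((integrable_inv_sq_add_sq x hδ.ne').ofReal.const_mul _)
    have h2 := h1.2
    rw [hasFiniteIntegral_iff_enorm] at h2
    refine (lt_of_eq_of_lt (lintegral_congr fun y => ?_) h2).ne
    rw [enorm_mul, ← ofReal_norm (((((y - x) ^ 2 + δ ^ 2)⁻¹ : ℝ) : ℂ)), Complex.norm_real,
      Real.norm_of_nonneg (by positivity)]
  -- Since `δ < |y - x|`, the Poisson kernel is at most `2 ε / ((y - x)² + δ²)`, whose integral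
  -- against `‖g y - g x‖` is `O(ε)`.
  have hfar : ∀ ε > 0, ∫⁻ y in (Metric.closedBall x δ)ᶜ,
      ‖g y - g x‖ₑ * ENNReal.ofReal (ε / ((y - x) ^ 2 + ε ^ 2)) ≤ ENNReal.ofReal (2 * ε) * M := by
    intro ε hε
    have hmul : AEMeasurable fun y =>
        ‖g y - g x‖ₑ * ENNReal.ofReal (((y - x) ^ 2 + δ ^ 2)⁻¹) := hm.mul (by fun_prop)
    rw [← lintegral_const_mul'' _ hmul]
    refine (setLIntegral_mono_ae' Metric.isClosed_closedBall.measurableSet.compl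
      (Eventually.of_forall fun y hy => ?_)).trans (setLIntegral_le_lintegral _ _)
    rw [mul_left_comm]
    gcongr
    rw [← ENNReal.ofReal_mul (by positivity)]
    refine ENNReal.ofReal_le_ofReal ?_
    have hy' : δ < |y - x| := by simpa [Real.dist_eq] using hy
    have h3 : δ ^ 2 < (y - x) ^ 2 := by
      rw [← sq_abs (y - x)]
      gcongr
    rw [← div_eq_mul_inv, div_le_div_iff₀ (by positivity) (by positivity)]
    nlinarith [sq_nonneg ε]
  have hlim : Tendsto (fun ε : ℝ => ENNReal.ofReal (2 * ε) * M) (𝓝[>] 0) (𝓝 0) := by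
    have h1 : Tendsto (fun ε : ℝ => ENNReal.ofReal (2 * ε)) (𝓝[>] 0) (𝓝 0) := by
      have : Tendsto (fun ε : ℝ => 2 * ε) (𝓝[>] 0) (𝓝 (2 * 0)) :=
        ((continuous_const.mul continuous_id).tendsto 0).mono_left nhdsWithin_le_nhds
      simpa using ENNReal.tendsto_ofReal this
    simpa using ENNReal.Tendsto.mul_const h1 (Or.inr hM)
  filter_upwards [ENNReal.tendsto_nhds_zero.1 hlim (κ / 2) (ENNReal.half_pos hκ.ne'),
    self_mem_nhdsWithin] with ε h1 h2
  rw [← lintegral_add_compl _ (Metric.isClosed_closedBall (x := x) (ε := δ)).measurableSet]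
  calc _ ≤ κ / 2 + κ / 2 := add_le_add (hnear ε h2) ((hfar ε h2).trans h1)
    _ = κ := ENNReal.add_halves κ

theorem integral_poisson_eq_pi (x : ℝ) {ε : ℝ} (hε : 0 < ε) :
    ∫ y : ℝ, ε / ((y - x) ^ 2 + ε ^ 2) = Real.pi := by
  rw [integral_sub_right_eq_self (fun y : ℝ => ε / (y ^ 2 + ε ^ 2)) x]
  have h := Measure.integral_comp_div (fun y : ℝ => (1 + y ^ 2)⁻¹) ε
  rw [integral_univ_inv_one_add_sq, abs_of_pos hε, smul_eq_mul] at h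
  have h2 : ∀ y : ℝ, ε / (y ^ 2 + ε ^ 2) = ε⁻¹ * (1 + (y / ε) ^ 2)⁻¹ := fun y => by
    field_simp
    ring
  simp_rw [h2]
  rw [integral_const_mul, h, inv_mul_cancel_left₀ hε.ne']

theorem integrable_poisson (x : ℝ) {ε : ℝ} (hε : 0 < ε) :
    Integrable fun y : ℝ => ε / ((y - x) ^ 2 + ε ^ 2) :=
  (integrable_inv_sq_add_sq x hε.ne').const_mul ε

theorem ae_tendsto_average_closedBall {g : ℝ → ℂ} (hg : MemLp g 2 volume) :
    ∀ᵐ x, Tendsto (fun r => ⨍ y in Metric.closedBall x r, ‖g y - g x‖) (𝓝[>] 0) (𝓝 0) := by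
  filter_upwards [(Besicovitch.vitaliFamily volume).ae_tendsto_average_norm_sub
    (hg.locallyIntegrable one_le_two)] with x hx
  exact hx.comp (Besicovitch.tendsto_filterAt volume x)

/-- Needed for two kernels: the Poisson kernel itself, and the difference of the truncated and
conjugate Poisson kernels. -/
theorem tendsto_integral_of_norm_le_poisson {g : ℝ → ℂ} (hg : MemLp g 2 volume) {x : ℝ}
    (hx : Tendsto (fun r => ⨍ y in Metric.closedBall x r, ‖g y - g x‖) (𝓝[>] 0) (𝓝 0))
    (k : ℝ → ℝ → ℝ) (hk : ∀ ε > 0, ∀ y, |k ε y| ≤ ε / ((y - x) ^ 2 + ε ^ 2)) :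
    Tendsto (fun ε : ℝ => ∫ y, (k ε y : ℂ) * (g y - g x)) (𝓝[>] 0) (𝓝 0) := by
  rw [tendsto_zero_iff_enorm_tendsto_zero]
  refine tendsto_of_tendsto_of_tendsto_of_le_of_le' tendsto_const_nhds
    (tendsto_lintegral_poisson hg hx) (Eventually.of_forall fun _ => zero_le) ?_
  filter_upwards [self_mem_nhdsWithin] with ε hε
  refine (enorm_integral_le_lintegral_enorm _).trans (lintegral_mono fun y => ?_)
  rw [enorm_mul, mul_comm]
  gcongr
  rw [← ofReal_norm, Complex.norm_real]
  exact ENNReal.ofReal_le_ofReal (hk ε hε y)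

/-! ### The principal value formula -/

/-- The truncated and the conjugate Poisson kernels differ by at most the Poisson kernel. -/
theorem abs_truncated_sub_conjPoisson_le (x : ℝ) {ε : ℝ} (hε : 0 < ε) (y : ℝ) :
    |{y | ε < |y - x|}.indicator (fun y => (y - x)⁻¹) y - (y - x) / ((y - x) ^ 2 + ε ^ 2)| ≤
      ε / ((y - x) ^ 2 + ε ^ 2) := by
  have hpos : 0 < (y - x) ^ 2 + ε ^ 2 := by positivity
  by_cases hy : ε < |y - x|
  · have h0 : 0 < |y - x| := hε.trans hy
    have h1 : y - x ≠ 0 := abs_pos.1 h0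
    rw [Set.indicator_of_mem (show y ∈ {y | ε < |y - x|} from hy)]
    have h2 : (y - x)⁻¹ - (y - x) / ((y - x) ^ 2 + ε ^ 2) =
        ε ^ 2 / ((y - x) * ((y - x) ^ 2 + ε ^ 2)) := by
      field_simp
      ring
    rw [h2, abs_div, abs_mul, abs_of_pos hpos, abs_of_pos (by positivity : 0 < ε ^ 2),
      div_le_div_iff₀ (by positivity) hpos]
    have : ε ^ 2 * ((y - x) ^ 2 + ε ^ 2) ≤ (ε * |y - x|) * ((y - x) ^ 2 + ε ^ 2) := by
      gcongr
      nlinarith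
    linarith
  · rw [Set.indicator_of_notMem (show y ∉ {y | ε < |y - x|} from hy), zero_sub, abs_neg, abs_div,
      abs_of_pos hpos]
    gcongr
    exact not_lt.1 hy

theorem measurableSet_lt_abs_sub (x ε : ℝ) : MeasurableSet {y : ℝ | ε < |y - x|} :=
  measurableSet_lt measurable_const (by fun_prop)

theorem memLp_truncated_inv (x : ℝ) {ε : ℝ} (hε : 0 < ε) :
    MemLp ({y : ℝ | ε < |y - x|}.indicator fun y => (((y - x)⁻¹ : ℝ) : ℂ)) 2 volume := by
  have hm : AEStronglyMeasurable ({y : ℝ | ε < |y - x|}.indicator fun y => (((y - x)⁻¹ : ℝ) : ℂ))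
      volume :=
    (Measurable.indicator (by fun_prop) (measurableSet_lt_abs_sub x ε)).aestronglyMeasurable
  rw [memLp_two_iff_integrable_sq_norm hm]
  refine ((integrable_inv_sq_add_sq x hε.ne').const_mul 2).mono' (hm.norm.pow 2)
    (Eventually.of_forall fun y => ?_)
  by_cases hy : ε < |y - x|
  · have h1 : ε ^ 2 < (y - x) ^ 2 := by
      rw [← sq_abs (y - x)]
      gcongr
    rw [Set.indicator_of_mem (show y ∈ {y | ε < |y - x|} from hy), Complex.norm_real, norm_pow,
      norm_norm, ← norm_pow, Real.norm_of_nonneg (by positivity), inv_pow, ← div_eq_mul_inv,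
      inv_le_comm₀ (by nlinarith [sq_nonneg ε]) (by positivity), inv_div]
    nlinarith
  · rw [Set.indicator_of_notMem (show y ∉ {y | ε < |y - x|} from hy)]
    simp only [norm_zero, ne_eq, OfNat.ofNat_ne_zero, not_false_eq_true, zero_pow]
    positivity

/-- The Hilbert transform on `L²(ℝ)` is given almost everywhere by the principal value integral. -/
theorem ae_tendsto_hilbertLine (f : L2Line) :
    ∀ᵐ x : ℝ, Tendsto (fun ε : ℝ => (1 / (Real.pi : ℂ)) *
      ∫ y in {y : ℝ | ε < |y - x|}, f y / ((y : ℂ) - x)) (𝓝[>] 0) (𝓝 (hilbertLine f x)) := by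
  filter_upwards [ae_tendsto_average_closedBall (Lp.memLp f),
    ae_tendsto_average_closedBall (Lp.memLp (hilbertLine f))] with x hx hHx
  set k : ℝ → ℝ → ℝ := fun ε y =>
    {y | ε < |y - x|}.indicator (fun y => (y - x)⁻¹) y - (y - x) / ((y - x) ^ 2 + ε ^ 2) with hk
  have h1 := tendsto_integral_of_norm_le_poisson (Lp.memLp f) hx k fun ε hε y =>
    abs_truncated_sub_conjPoisson_le x hε y
  have h2 := tendsto_integral_of_norm_le_poisson (Lp.memLp (hilbertLine f)) hHx
    (fun ε y => ε / ((y - x) ^ 2 + ε ^ 2)) fun ε hε y => (abs_of_pos (by positivity)).le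
  -- The conjugate Poisson integral of `f` in the first term cancels the Poisson integral of `Hf` in
  -- the second, leaving the truncated integral.
  have h3 := ((h1.add h2).const_mul (1 / (Real.pi : ℂ))).add_const (hilbertLine f x)
  simp only [add_zero, mul_zero, zero_add] at h3
  refine h3.congr' ?_
  filter_upwards [self_mem_nhdsWithin] with ε hε
  have hε : 0 < ε := hε
  have hmemP : MemLp (fun y : ℝ => ((ε / ((y - x) ^ 2 + ε ^ 2) : ℝ) : ℂ)) 2 volume :=
    ((memLp_inv_sq_add_sq x hε.ne').const_mul ε).ofReal
  have hkm : Measurable (k ε) := by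
    refine (Measurable.indicator (by fun_prop) (measurableSet_lt_abs_sub x ε)).sub (by fun_prop)
  have hkint : Integrable (k ε) := (integrable_poisson x hε).mono' hkm.aestronglyMeasurable
    (Eventually.of_forall fun y => abs_truncated_sub_conjPoisson_le x hε y)
  have hkmem : MemLp (fun y => (k ε y : ℂ)) 2 volume :=
    hmemP.of_le (by fun_prop) (Eventually.of_forall fun y => by
      rw [Complex.norm_real, Complex.norm_real]
      refine le_trans ?_ (le_abs_self _)
      exact abs_truncated_sub_conjPoisson_le x hε y)
  -- The kernel is odd about `x`, so subtracting the constant `f x` does not change the integral.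
  have hk0 : ∫ y, k ε y = 0 := by
    have hodd : ∀ y, k ε (2 * x - y) = -k ε y := fun y => by
      have e1 : 2 * x - y - x = -(y - x) := by ring
      simp only [hk, Set.indicator_apply, Set.mem_ofPred_eq, e1, abs_neg, inv_neg, neg_sq]
      split_ifs <;> ring
    have h4 := integral_sub_left_eq_self (k ε) volume (2 * x)
    simp_rw [hodd, integral_neg] at h4
    linarith
  have e1 : ∫ y, (k ε y : ℂ) * (f y - f x) = ∫ y, (k ε y : ℂ) * f y := by
    have hc : Integrable fun y => (k ε y : ℂ) * f x := hkint.ofReal.mul_const _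
    simp_rw [mul_sub]
    rw [integral_sub (integrable_mul_of_memLp_two hkmem (Lp.memLp f)) hc,
      integral_mul_const, integral_complex_ofReal, hk0]
    simp
  have e2 : ∫ y, ((ε / ((y - x) ^ 2 + ε ^ 2) : ℝ) : ℂ) * (hilbertLine f y - hilbertLine f x) =
      (∫ y, (((y - x) / ((y - x) ^ 2 + ε ^ 2) : ℝ) : ℂ) * f y) - Real.pi * hilbertLine f x := by
    have hc : Integrable fun y =>
        ((ε / ((y - x) ^ 2 + ε ^ 2) : ℝ) : ℂ) * hilbertLine f x :=
      (integrable_poisson x hε).ofReal.mul_const _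
    simp_rw [mul_sub]
    rw [integral_sub (integrable_mul_of_memLp_two hmemP (Lp.memLp _)) hc, integral_mul_const,
      integral_complex_ofReal,
      integral_poisson_eq_pi x hε, integral_poisson_hilbertLine f x hε]
  have e3 : ∫ y in {y : ℝ | ε < |y - x|}, f y / ((y : ℂ) - x) =
      ∫ y, ({y : ℝ | ε < |y - x|}.indicator (fun y => (((y - x)⁻¹ : ℝ) : ℂ)) y) * f y := by
    rw [← integral_indicator (measurableSet_lt_abs_sub x ε)]
    refine integral_congr_ae (Eventually.of_forall fun y => ?_)
    simp only [Set.indicator_apply]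
    split_ifs
    · push_cast
      rw [div_eq_mul_inv, mul_comm]
    · rw [zero_mul]
  have e4 : ∫ y, (k ε y : ℂ) * f y = (∫ y in {y : ℝ | ε < |y - x|}, f y / ((y : ℂ) - x)) -
      ∫ y, (((y - x) / ((y - x) ^ 2 + ε ^ 2) : ℝ) : ℂ) * f y := by
    have h5 : ∀ y, (((y - x) / ((y - x) ^ 2 + ε ^ 2) : ℝ) : ℂ) * f y =
        ({y : ℝ | ε < |y - x|}.indicator (fun y => (((y - x)⁻¹ : ℝ) : ℂ)) y) * f y -
          (k ε y : ℂ) * f y := fun y => by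
      simp only [hk, Set.indicator_apply]
      split_ifs <;> push_cast <;> ring
    simp_rw [h5]
    rw [integral_sub (integrable_mul_of_memLp_two (memLp_truncated_inv x hε) (Lp.memLp f))
      (integrable_mul_of_memLp_two hkmem (Lp.memLp f)), e3]
    ring
  rw [e1, e2, e4]
  have : (Real.pi : ℂ) ≠ 0 := Complex.ofReal_ne_zero.2 Real.pi_ne_zero
  field_simp
  ring

/-! ### Multipliers and commutators with the Hilbert transform -/

theorem IsCompactOperator.of_forall_eq {E F : Type*} [Zero E] [TopologicalSpace E]
    [Zero F] [TopologicalSpace F] {f g : E → F} (hf : IsCompactOperator f) (h : ∀ x, g x = f x) :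
    IsCompactOperator g := by
  rwa [funext h]

/-- Measurable functions with values in `[-1, 1]`. -/
def IsMultiplier (φ : ℝ → ℝ) : Prop :=
  Measurable φ ∧ ∀ x, |φ x| ≤ 1

theorem IsMultiplier.memLp_mul {φ : ℝ → ℝ} (h : IsMultiplier φ) (f : L2Line) :
    MemLp (fun x => (φ x : ℂ) * f x) 2 volume := by
  have hm : AEStronglyMeasurable (fun x => (φ x : ℂ)) volume :=
    (Complex.measurable_ofReal.comp h.1).aestronglyMeasurable
  refine (Lp.memLp f).of_le (hm.mul (Lp.aestronglyMeasurable f)) (Eventually.of_forall fun x => ?_)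
  rw [norm_mul, Complex.norm_real]
  exact mul_le_of_le_one_left (norm_nonneg _) (h.2 x)

open Classical in
/-- Multiplication by `φ` on `L²(ℝ)`. -/
noncomputable def mulLine (φ : ℝ → ℝ) : L2Line →L[ℂ] L2Line :=
  if h : IsMultiplier φ then
    LinearMap.mkContinuous
      { toFun := fun f => (h.memLp_mul f).toLp _
        map_add' := fun f g => by
          rw [← MemLp.toLp_add, MemLp.toLp_eq_toLp_iff]
          filter_upwards [Lp.coeFn_add f g] with x hx
          rw [Pi.add_apply, hx, Pi.add_apply, mul_add]
        map_smul' := fun c f => by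
          rw [RingHom.id_apply, ← MemLp.toLp_const_smul, MemLp.toLp_eq_toLp_iff]
          filter_upwards [Lp.coeFn_smul c f] with x hx
          simp [hx, mul_left_comm] } 1 fun f => by
      refine Lp.norm_le_mul_norm_of_ae_le_mul ?_
      filter_upwards [(h.memLp_mul f).coeFn_toLp] with x hx
      change ‖(h.memLp_mul f).toLp _ x‖ ≤ _
      rw [hx, norm_mul, Complex.norm_real]
      exact mul_le_mul_of_nonneg_right (h.2 x) (norm_nonneg _)
  -- Junk value; the rules from `coeFn_mulLine` on assume `IsMultiplier`.
  else 0

theorem coeFn_mulLine {φ : ℝ → ℝ} (h : IsMultiplier φ) (f : L2Line) :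
    mulLine φ f =ᵐ[volume] fun x => (φ x : ℂ) * f x := by
  rw [mulLine, dif_pos h]
  exact (h.memLp_mul f).coeFn_toLp

theorem mulLine_mulLine {φ ψ χ : ℝ → ℝ} (hφ : IsMultiplier φ) (hψ : IsMultiplier ψ)
    (hχ : IsMultiplier χ) (h : ∀ x, φ x * ψ x = χ x) (f : L2Line) :
    mulLine φ (mulLine ψ f) = mulLine χ f := by
  refine Lp.ext ?_
  filter_upwards [coeFn_mulLine hφ (mulLine ψ f), coeFn_mulLine hψ f, coeFn_mulLine hχ f]
    with x h1 h2 h3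
  rw [h1, h2, h3, ← h x, Complex.ofReal_mul, mul_assoc]

theorem mulLine_mulLine_eq_zero {φ ψ : ℝ → ℝ} (hφ : IsMultiplier φ) (hψ : IsMultiplier ψ)
    (h : ∀ x, φ x * ψ x = 0) (f : L2Line) : mulLine φ (mulLine ψ f) = 0 := by
  refine Lp.ext ?_
  filter_upwards [coeFn_mulLine hφ (mulLine ψ f), coeFn_mulLine hψ f, Lp.coeFn_zero ℂ 2 volume]
    with x h1 h2 h3
  rw [h1, h2, h3, ← mul_assoc, ← Complex.ofReal_mul, h x]
  simp

theorem isMultiplier_indicator {s : Set ℝ} (hs : MeasurableSet s) :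
    IsMultiplier (s.indicator 1) := by
  refine ⟨measurable_one.indicator hs, fun x => ?_⟩
  by_cases hx : x ∈ s <;> simp [hx]

/-- Lipschitz functions with values in `[-1, 1]` and bounded support. -/
structure IsLipschitzBump (ψ : ℝ → ℝ) (L R : ℝ) : Prop where
  abs_le_one : ∀ x, |ψ x| ≤ 1
  abs_sub_le : ∀ x y, |ψ x - ψ y| ≤ L * |x - y|
  one_le : 1 ≤ R
  eq_zero : ∀ x, R < |x| → ψ x = 0

namespace IsLipschitzBump

variable {ψ : ℝ → ℝ} {L R : ℝ}

theorem nonneg (h : IsLipschitzBump ψ L R) : 0 ≤ L := by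
  have := h.abs_sub_le 0 1
  simp only [zero_sub, abs_neg, abs_one, mul_one] at this
  exact (abs_nonneg _).trans this

theorem isMultiplier (h : IsLipschitzBump ψ L R) : IsMultiplier ψ := by
  refine ⟨Continuous.measurable ?_, h.abs_le_one⟩
  refine (LipschitzWith.of_dist_le_mul (K := ⟨L, h.nonneg⟩) fun x y => ?_).continuous
  exact h.abs_sub_le x y

theorem measurable (h : IsLipschitzBump ψ L R) : Measurable ψ := h.isMultiplier.1

/-- If one variable exceeds `2 R` in modulus, `ψ` vanishes there, and the difference is nonzero only
when the other is at most `R`, so `|y - x|` controls the large one. Otherwise both weights are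
bounded and the Lipschitz bound suffices. The weights give the kernel decay on the whole line. -/
theorem sq_sub_le (h : IsLipschitzBump ψ L R) (x y : ℝ) :
    (1 + x ^ 2) * (1 + y ^ 2) * (ψ x - ψ y) ^ 2 ≤
      ((1 + 4 * R ^ 2) ^ 2 * L ^ 2 + 8 * (1 + R ^ 2)) * (y - x) ^ 2 := by
  have hR := h.one_le
  have far : ∀ x y, 2 * R < |y| → (1 + x ^ 2) * (1 + y ^ 2) * (ψ x - ψ y) ^ 2 ≤
      8 * (1 + R ^ 2) * (y - x) ^ 2 := by
    intro x y hy
    have hy0 : ψ y = 0 := h.eq_zero y (by linarith)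
    rcases lt_or_ge R |x| with hx | hx
    · rw [hy0, h.eq_zero x hx]
      simp only [sub_self, ne_eq, OfNat.ofNat_ne_zero, not_false_eq_true, zero_pow, mul_zero]
      positivity
    · have h1 : x ^ 2 ≤ R ^ 2 := by
        rw [← sq_abs x]
        gcongr
      have h2 : (ψ x) ^ 2 ≤ 1 := by
        rw [← sq_abs]
        exact pow_le_one₀ (abs_nonneg _) (h.abs_le_one x)
      have h3 : |y| ≤ 2 * |y - x| := by
        have := abs_sub_abs_le_abs_sub y x
        linarith
      have h4 : y ^ 2 ≤ 4 * (y - x) ^ 2 := by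
        rw [← sq_abs y, ← sq_abs (y - x)]
        nlinarith [abs_nonneg y, abs_nonneg (y - x)]
      have h5 : 1 ≤ y ^ 2 := by
        rw [← sq_abs y]
        nlinarith
      rw [hy0, sub_zero]
      calc (1 + x ^ 2) * (1 + y ^ 2) * (ψ x) ^ 2 ≤ (1 + R ^ 2) * (8 * (y - x) ^ 2) * 1 := by
            gcongr
            linarith
        _ = _ := by ring
  have hnn : 0 ≤ (1 + 4 * R ^ 2) ^ 2 * L ^ 2 * (y - x) ^ 2 := by positivity
  have hnn' : 0 ≤ 8 * (1 + R ^ 2) * (y - x) ^ 2 := by positivity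
  rw [add_mul]
  rcases lt_or_ge (2 * R) |y| with hy | hy
  · linarith [far x y hy]
  rcases lt_or_ge (2 * R) |x| with hx | hx
  · have e1 : (ψ y - ψ x) ^ 2 = (ψ x - ψ y) ^ 2 := by ring
    have e2 : (x - y) ^ 2 = (y - x) ^ 2 := by ring
    have := far y x hx
    rw [e1, e2, mul_comm (1 + y ^ 2)] at this
    linarith
  · have key : ∀ z : ℝ, |z| ≤ 2 * R → 1 + z ^ 2 ≤ 1 + 4 * R ^ 2 := fun z hz => by
      rw [← sq_abs z]
      nlinarith [abs_nonneg z]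
    have h1 : (ψ x - ψ y) ^ 2 ≤ L ^ 2 * (y - x) ^ 2 := by
      rw [← sq_abs, ← mul_pow, ← sq_abs (L * (y - x)), abs_mul, abs_of_nonneg h.nonneg,
        abs_sub_comm y x]
      exact pow_le_pow_left₀ (abs_nonneg _) (h.abs_sub_le x y) 2
    have : (1 + x ^ 2) * (1 + y ^ 2) * (ψ x - ψ y) ^ 2 ≤
        (1 + 4 * R ^ 2) * (1 + 4 * R ^ 2) * (L ^ 2 * (y - x) ^ 2) := by
      gcongr ?_ * ?_ * ?_
      · exact key x hx
      · exact key y hy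
    linarith

/-- The commutator kernel of a Lipschitz bump is square-integrable. -/
theorem exists_sq_kernel_le (h : IsLipschitzBump ψ L R) :
    ∃ C : ℝ, 0 ≤ C ∧ ∀ x y, ((ψ x - ψ y) / (y - x)) ^ 2 ≤ C * ((1 + x ^ 2)⁻¹ * (1 + y ^ 2)⁻¹) := by
  refine ⟨(1 + 4 * R ^ 2) ^ 2 * L ^ 2 + 8 * (1 + R ^ 2), by positivity, fun x y => ?_⟩
  rcases eq_or_ne y x with rfl | hxy
  · simp only [sub_self, div_zero, ne_eq, OfNat.ofNat_ne_zero, not_false_eq_true, zero_pow]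
    positivity
  · have : 0 < (y - x) ^ 2 := by
      have := sub_ne_zero.2 hxy
      positivity
    rw [div_pow, div_le_iff₀ this, ← mul_inv, mul_right_comm, ← div_eq_mul_inv,
      le_div_iff₀ (by positivity), mul_comm]
    exact h.sq_sub_le x y

theorem memLp_kernel (h : IsLipschitzBump ψ L R) (x : ℝ) :
    MemLp (fun y => (((ψ x - ψ y) / (y - x) : ℝ) : ℂ)) 2 volume := by
  obtain ⟨C, hC, hk⟩ := h.exists_sq_kernel_le
  have := h.measurable
  have hm : Measurable (fun y => (((ψ x - ψ y) / (y - x) : ℝ) : ℂ)) := by fun_prop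
  rw [memLp_two_iff_integrable_sq_norm hm.aestronglyMeasurable]
  refine ((integrable_inv_one_add_sq.const_mul ((1 + x ^ 2)⁻¹)).const_mul C).mono'
    (hm.norm.pow_const 2).aestronglyMeasurable (Eventually.of_forall fun y => ?_)
  rw [norm_pow, norm_norm, Complex.norm_real, Real.norm_eq_abs, sq_abs]
  exact hk x y

/-- The commutator of the Hilbert transform with a Lipschitz bump is an integral operator. -/
theorem ae_commutator_eq (h : IsLipschitzBump ψ L R) (f : L2Line) :
    ∀ᵐ x : ℝ, (mulLine ψ (hilbertLine f) - hilbertLine (mulLine ψ f) : L2Line) x =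
      (1 / (Real.pi : ℂ)) * ∫ y, (((ψ x - ψ y) / (y - x) : ℝ) : ℂ) * f y := by
  filter_upwards [ae_tendsto_hilbertLine f, ae_tendsto_hilbertLine (mulLine ψ f),
    Lp.coeFn_sub (mulLine ψ (hilbertLine f)) (hilbertLine (mulLine ψ f)),
    coeFn_mulLine h.isMultiplier (hilbertLine f)] with x h1 h2 h3 h4
  rw [h3, Pi.sub_apply, h4]
  refine tendsto_nhds_unique ((h1.const_mul (ψ x : ℂ)).sub h2) ?_
  have hint := integrable_mul_of_memLp_two (h.memLp_kernel x) (Lp.memLp f)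
  -- The two singularities cancel: the remaining kernel times `f` is integrable, so dominated
  -- convergence removes the cutoff.
  have hlim : Tendsto (fun ε : ℝ => ∫ y, {y : ℝ | ε < |y - x|}.indicator
      (fun y => (((ψ x - ψ y) / (y - x) : ℝ) : ℂ) * f y) y) (𝓝[>] 0)
      (𝓝 (∫ y, (((ψ x - ψ y) / (y - x) : ℝ) : ℂ) * f y)) := by
    refine tendsto_integral_filter_of_dominated_convergence
      (fun y => ‖(((ψ x - ψ y) / (y - x) : ℝ) : ℂ) * f y‖) ?_ ?_ hint.norm ?_
    · exact Eventually.of_forall fun ε => hint.1.indicator (measurableSet_lt_abs_sub x ε)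
    · exact Eventually.of_forall fun ε => Eventually.of_forall fun y =>
        norm_indicator_le_norm_self _ _
    · refine Eventually.of_forall fun y => ?_
      by_cases hy : y = x
      · subst hy
        simp [Set.indicator_apply]
      · refine tendsto_const_nhds.congr' ?_
        have : 0 < |y - x| := abs_pos.2 (sub_ne_zero.2 hy)
        filter_upwards [nhdsWithin_le_nhds (gt_mem_nhds this)] with ε hε
        rw [Set.indicator_of_mem (show y ∈ {y : ℝ | ε < |y - x|} from hε)]
  refine (hlim.const_mul (1 / (Real.pi : ℂ))).congr' ?_
  filter_upwards [self_mem_nhdsWithin] with ε hε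
  have hset := measurableSet_lt_abs_sub x ε
  have hcut : ∀ g : L2Line, ∫ y in {y : ℝ | ε < |y - x|}, g y / ((y : ℂ) - x) =
      ∫ y, ({y : ℝ | ε < |y - x|}.indicator (fun y => (((y - x)⁻¹ : ℝ) : ℂ)) y) * g y := by
    intro g
    rw [← integral_indicator hset]
    refine integral_congr_ae (Eventually.of_forall fun y => ?_)
    simp only [Set.indicator_apply]
    split_ifs
    · push_cast
      rw [div_eq_mul_inv, mul_comm]
    · rw [zero_mul]
  have hI : ∀ g : L2Line, Integrable fun y =>
      ({y : ℝ | ε < |y - x|}.indicator (fun y => (((y - x)⁻¹ : ℝ) : ℂ)) y) * g y := fun g =>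
    integrable_mul_of_memLp_two (memLp_truncated_inv x hε) (Lp.memLp g)
  rw [hcut, hcut, mul_left_comm, ← mul_sub]
  rw [← integral_const_mul (ψ x : ℂ), ← integral_sub ((hI f).const_mul _) (hI _)]
  congr 1
  refine integral_congr_ae ?_
  filter_upwards [coeFn_mulLine h.isMultiplier f] with y hy
  simp only [Set.indicator_apply, hy]
  split_ifs
  · push_cast
    rw [div_eq_mul_inv]
    ring
  · simp

/-- Lipschitz bumps commute with the Hilbert transform modulo compact operators. -/
theorem isCompactOperator_commutator (h : IsLipschitzBump ψ L R) :
    IsCompactOperator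
      ((mulLine ψ ∘L hilbertLine - hilbertLine ∘L mulLine ψ : L2Line →L[ℂ] L2Line) :
        L2Line → L2Line) := by
  obtain ⟨C, hC, hk⟩ := h.exists_sq_kernel_le
  -- The majorant comes from integrating the kernel bound in `y`, where `(1 + y²)⁻¹` has integral
  -- `π`.
  refine isCompactOperator_of_inner_kernel _
    (fun x => (1 / (Real.pi : ℂ)) • (h.memLp_kernel x).toLp _)
    (fun x => (1 / Real.pi) * √(C * Real.pi * (1 + x ^ 2)⁻¹)) ?_ ?_ ?_
  · have h1 : ∀ x : ℝ, ((1 / Real.pi) * √(C * Real.pi * (1 + x ^ 2)⁻¹)) ^ 2 =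
        ((1 / Real.pi) ^ 2 * (C * Real.pi)) * (1 + x ^ 2)⁻¹ := fun x => by
      have := Real.pi_pos
      rw [mul_pow, Real.sq_sqrt (by positivity)]
      ring
    simp_rw [h1]
    exact integrable_inv_one_add_sq.const_mul _
  · intro x
    have hpi := Real.pi_pos
    rw [norm_smul, norm_div, norm_one, Complex.norm_real, Real.norm_of_nonneg hpi.le]
    gcongr
    refine Real.le_sqrt_of_sq_le ?_
    rw [← inner_self_eq_norm_sq (𝕜 := ℂ), L2.inner_def, ← integral_re (L2.integrable_inner _ _)]
    have h2 : ∫ y : ℝ, C * ((1 + x ^ 2)⁻¹ * (1 + y ^ 2)⁻¹) = C * Real.pi * (1 + x ^ 2)⁻¹ := by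
      rw [integral_const_mul, integral_const_mul, integral_univ_inv_one_add_sq]
      ring
    rw [← h2]
    refine integral_mono_ae (L2.integrable_inner _ _).re
      ((integrable_inv_one_add_sq.const_mul _).const_mul _) ?_
    filter_upwards [(h.memLp_kernel x).coeFn_toLp] with y hy
    rw [inner_self_eq_norm_sq, hy, Complex.norm_real, Real.norm_eq_abs, sq_abs]
    exact hk x y
  · intro f
    filter_upwards [h.ae_commutator_eq f] with x hx
    refine Eq.trans hx ?_
    rw [inner_smul_left, L2.inner_def]
    congr 1
    · simp
    · refine integral_congr_ae ?_
      filter_upwards [(h.memLp_kernel x).coeFn_toLp] with y hy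
      rw [hy, RCLike.inner_apply, Complex.conj_ofReal, mul_comm]

/-- `ψ H φ` is compact if `ψ φ = 0`. -/
theorem isCompactOperator_mul_hilbert (h : IsLipschitzBump ψ L R) {φ : ℝ → ℝ}
    (hφ : IsMultiplier φ) (h0 : ∀ x, ψ x * φ x = 0) :
    IsCompactOperator fun f => mulLine ψ (hilbertLine (mulLine φ f)) := by
  refine (h.isCompactOperator_commutator.comp_clm (mulLine φ)).of_forall_eq fun f => ?_
  simp [mulLine_mulLine_eq_zero h.isMultiplier hφ h0]

/-- `φ H ψ` is compact if `φ ψ = 0`. -/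
theorem isCompactOperator_hilbert_mul (h : IsLipschitzBump ψ L R) {φ : ℝ → ℝ}
    (hφ : IsMultiplier φ) (h0 : ∀ x, φ x * ψ x = 0) :
    IsCompactOperator fun f => mulLine φ (hilbertLine (mulLine ψ f)) := by
  refine (h.isCompactOperator_commutator.clm_comp (mulLine φ)).neg.of_forall_eq fun f => ?_
  simp [mulLine_mulLine_eq_zero hφ h.isMultiplier h0]

/-- `φ H ψ H χ` is compact if `φ χ = 0`. -/
theorem isCompactOperator_mul_hilbert_hilbert_mul (h : IsLipschitzBump ψ L R) {φ χ : ℝ → ℝ}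
    (hφ : IsMultiplier φ) (hχ : IsMultiplier χ) (h0 : ∀ x, φ x * χ x = 0) :
    IsCompactOperator fun f =>
      mulLine φ (hilbertLine (mulLine ψ (hilbertLine (mulLine χ f)))) := by
  -- Expand `φ [ψ, H] H χ`: the term with `H² = -1` is a multiple of `φ ψ χ = 0`, and the other is
  -- the operator sought up to sign.
  refine ((h.isCompactOperator_commutator.clm_comp (mulLine φ)).comp_clm
    (hilbertLine ∘L mulLine χ)).neg.of_forall_eq fun f => ?_
  have h1 : mulLine φ (mulLine ψ (mulLine χ f)) = 0 := by
    have h2 : IsMultiplier fun x => φ x * ψ x := by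
      refine ⟨hφ.1.mul h.measurable, fun x => ?_⟩
      rw [abs_mul]
      exact mul_le_one₀ (hφ.2 x) (abs_nonneg _) (h.abs_le_one x)
    rw [mulLine_mulLine hφ h.isMultiplier h2 fun x => rfl]
    exact mulLine_mulLine_eq_zero h2 hχ (fun x => by rw [mul_right_comm, h0, zero_mul]) f
  simp [hilbertLine_hilbertLine, h1]

end IsLipschitzBump

/-! ### Trapezoidal cutoffs -/

/-- The trapezoidal function supported in `[p, q]` with slopes `1 / d`. -/
noncomputable def trapezoid (p q d x : ℝ) : ℝ :=
  max 0 (min 1 (min ((x - p) / d) ((q - x) / d)))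

theorem trapezoid_of_le_left {p q d x : ℝ} (hd : 0 < d) (hx : x ≤ p) : trapezoid p q d x = 0 :=
  max_eq_left ((min_le_right _ _).trans ((min_le_left _ _).trans
    (div_nonpos_of_nonpos_of_nonneg (by linarith) hd.le)))

theorem trapezoid_of_right_le {p q d x : ℝ} (hd : 0 < d) (hx : q ≤ x) : trapezoid p q d x = 0 :=
  max_eq_left ((min_le_right _ _).trans ((min_le_right _ _).trans
    (div_nonpos_of_nonpos_of_nonneg (by linarith) hd.le)))

theorem trapezoid_eq_one {p q d x : ℝ} (hd : 0 < d) (h1 : p + d ≤ x) (h2 : x ≤ q - d) :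
    trapezoid p q d x = 1 := by
  have h3 : 1 ≤ (x - p) / d := (one_le_div hd).2 (by linarith)
  have h4 : 1 ≤ (q - x) / d := (one_le_div hd).2 (by linarith)
  rw [trapezoid, min_eq_left (le_min h3 h4), max_eq_right zero_le_one]

theorem isLipschitzBump_trapezoid (p q : ℝ) {d : ℝ} (hd : 0 < d) :
    IsLipschitzBump (trapezoid p q d) (1 / d) (max 1 (max |p| |q|)) where
  abs_le_one x := by
    rw [abs_of_nonneg (le_max_left _ _)]
    exact max_le zero_le_one (min_le_left _ _)
  abs_sub_le x y := by
    have h1 : |(x - p) / d - (y - p) / d| = 1 / d * |x - y| := by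
      rw [← sub_div, abs_div, abs_of_pos hd, sub_sub_sub_cancel_right]
      ring
    have h2 : |(q - x) / d - (q - y) / d| = 1 / d * |x - y| := by
      rw [← sub_div, abs_div, abs_of_pos hd, sub_sub_sub_cancel_left, abs_sub_comm]
      ring
    have h0 : 0 ≤ 1 / d * |x - y| := by positivity
    refine (abs_max_sub_max_le_max _ _ _ _).trans (max_le (by simpa using h0) ?_)
    refine (abs_min_sub_min_le_max _ _ _ _).trans (max_le (by simpa using h0) ?_)
    exact (abs_min_sub_min_le_max _ _ _ _).trans (max_le h1.le h2.le)
  one_le := le_max_left _ _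
  eq_zero x hx := by
    have h1 := (le_max_right _ _).trans_lt hx
    have h2 := (le_max_left _ _).trans_lt h1
    have h3 := (le_max_right _ _).trans_lt h1
    rcases le_total 0 x with h | h
    · rw [abs_of_nonneg h] at h3
      exact trapezoid_of_right_le hd ((le_abs_self q).trans h3.le)
    · rw [abs_of_nonpos h] at h2
      exact trapezoid_of_le_left hd (by linarith [neg_abs_le p])

/-- With `u = (x - p) / d` and `v = (q - x) / d`, the terms are `max 0 (1 - u)`, `max 0 (1 - v)` and
`min 1 (min u v)`. As `u + v ≥ 2`, at most one of `u`, `v` is below `1`. -/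
theorem trapezoid_partition {p q d x : ℝ} (hd : 0 < d) (hpq : 2 * d ≤ q - p) (h1 : p < x)
    (h2 : x < q) : trapezoid (p - d) (p + d) d x + trapezoid (q - d) (q + d) d x +
      trapezoid p q d x = 1 := by
  have e1 : (x - (p - d)) / d = (x - p) / d + 1 := by field_simp; ring
  have e2 : (p + d - x) / d = 1 - (x - p) / d := by field_simp; ring
  have e3 : (x - (q - d)) / d = 1 - (q - x) / d := by field_simp; ring
  have e4 : (q + d - x) / d = (q - x) / d + 1 := by field_simp; ring
  have hu : 0 < (x - p) / d := div_pos (by linarith) hd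
  have hv : 0 < (q - x) / d := div_pos (by linarith) hd
  have huv : 2 ≤ (x - p) / d + (q - x) / d := by
    rw [← add_div, le_div_iff₀ hd]
    linarith
  simp only [trapezoid, e1, e2, e3, e4]
  generalize (x - p) / d = u at *
  generalize (q - x) / d = v at *
  rw [min_eq_right (show 1 - u ≤ u + 1 by linarith), min_eq_right (show 1 - u ≤ 1 by linarith),
    min_eq_left (show 1 - v ≤ v + 1 by linarith), min_eq_right (show 1 - v ≤ 1 by linarith)]
  rcases le_total u 1 with hu1 | hu1
  · rw [max_eq_right (by linarith), max_eq_left (show 1 - v ≤ 0 by linarith),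
      min_eq_left (show u ≤ v by linarith), min_eq_right hu1, max_eq_right hu.le]
    ring
  · rw [max_eq_left (by linarith)]
    rcases le_total v 1 with hv1 | hv1
    · rw [max_eq_right (by linarith), min_eq_right (show v ≤ u by linarith), min_eq_right hv1,
        max_eq_right hv.le]
      ring
    · rw [max_eq_left (by linarith), min_eq_left (le_min hu1 hv1), max_eq_right zero_le_one]
      ring

/-! ### Cutoffs, restriction and extension by zero -/

/-- Multiplication by the indicator of a set. -/
noncomputable abbrev cutLine (s : Set ℝ) : L2Line →L[ℂ] L2Line := mulLine (s.indicator 1)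

theorem cutLine_cutLine_of_subset {s t : Set ℝ} (hs : MeasurableSet s) (ht : MeasurableSet t)
    (h : s ⊆ t) (f : L2Line) : cutLine t (cutLine s f) = cutLine s f :=
  mulLine_mulLine (isMultiplier_indicator ht) (isMultiplier_indicator hs)
    (isMultiplier_indicator hs) (fun x => by
      by_cases hx : x ∈ s
      · simp [hx, h hx]
      · simp [hx]) f

theorem cutLine_add_compl {s : Set ℝ} (hs : MeasurableSet s) (f : L2Line) :
    cutLine s f + cutLine sᶜ f = f := by
  refine Lp.ext ?_
  filter_upwards [Lp.coeFn_add (cutLine s f) (cutLine sᶜ f),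
    coeFn_mulLine (isMultiplier_indicator hs) f,
    coeFn_mulLine (isMultiplier_indicator hs.compl) f] with x h0 h1 h2
  rw [h0, Pi.add_apply, h1, h2]
  by_cases hx : x ∈ s <;> simp [hx]

/-- Multiplication by the indicator of a nonempty open interval is not compact. -/
theorem not_isCompactOperator_cutLine {c d : ℝ} (hcd : c < d) :
    ¬ IsCompactOperator (cutLine (Set.Ioo c d)) := by
  intro hcomp
  have hfin := ContinuousLinearMap.finite_dimensional_eigenspace hcomp 1 one_ne_zero
  -- Points decreasing from `d` towards `c`; the gaps between them are disjoint, so their indicators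
  -- form an infinite orthogonal family of fixed vectors of the cutoff.
  let e : ℕ → ℝ := fun n => c + (d - c) / (n + 1)
  have he : StrictAnti e := strictAnti_nat_of_succ_lt fun n => by
    have : 0 < d - c := sub_pos.2 hcd
    simp only [e]
    gcongr
    simp
  let s : ℕ → Set ℝ := fun n => Set.Ioo (e (n + 1)) (e n)
  have hs : ∀ n, MeasurableSet (s n) := fun n => measurableSet_Ioo
  have hs' : ∀ n, volume (s n) ≠ ⊤ := fun n => measure_Ioo_lt_top.ne
  have hsub : ∀ n, s n ⊆ Set.Ioo c d := fun n => by
    refine Set.Ioo_subset_Ioo ?_ ?_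
    · have : 0 < d - c := sub_pos.2 hcd
      simp only [e]
      have : 0 ≤ (d - c) / ((n + 1 : ℕ) + 1) := by positivity
      linarith
    · have := he.antitone (Nat.zero_le n)
      simpa [e] using this
  have hdisj : ∀ m n, m < n → s n ∩ s m = ∅ := fun m n hmn => by
    refine Set.eq_empty_of_forall_notMem fun x hx => ?_
    have := he.antitone (Nat.succ_le_of_lt hmn)
    exact absurd (hx.1.2.trans_le this) (not_lt.2 hx.2.1.le)
  let v : ℕ → L2Line := fun n => indicatorConstLp 2 (hs n) (hs' n) (1 : ℂ)
  have hv : ∀ n, v n =ᵐ[volume] (s n).indicator fun _ => (1 : ℂ) := fun n => indicatorConstLp_coeFn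
  have hmem : ∀ n, v n ∈ Module.End.eigenspace (cutLine (Set.Ioo c d)).toLinearMap 1 := fun n => by
    rw [Module.End.mem_eigenspace_iff, one_smul]
    refine Lp.ext ?_
    filter_upwards [coeFn_mulLine (isMultiplier_indicator measurableSet_Ioo) (v n), hv n]
      with x h1 h2
    refine h1.trans ?_
    rw [h2]
    by_cases hx : x ∈ s n
    · simp [hx, hsub n hx]
    · simp [hx]
  have horth : ∀ m n, m ≠ n → inner ℂ (v m) (v n) = 0 := by
    intro m n hmn
    rw [L2.inner_def]
    refine integral_eq_zero_of_ae ?_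
    filter_upwards [hv m, hv n] with x h1 h2
    rw [h1, h2]
    by_cases hx : x ∈ s m <;> by_cases hx' : x ∈ s n
    · exfalso
      rcases lt_or_gt_of_ne hmn with h | h
      · exact (hdisj m n h).subset ⟨hx', hx⟩
      · exact (hdisj n m h).subset ⟨hx, hx'⟩
    all_goals simp [hx, hx']
  have hne : ∀ n, v n ≠ 0 := fun n => by
    rw [← norm_ne_zero_iff, norm_indicatorConstLp two_ne_zero ENNReal.ofNat_ne_top]
    have : 0 < volume.real (s n) := by
      rw [Real.volume_real_Ioo]
      exact lt_max_of_lt_left (sub_pos.2 (he n.lt_succ_self))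
    exact mul_ne_zero (by simp) (Real.rpow_pos_of_pos this _).ne'
  have hli : LinearIndependent ℂ v := linearIndependent_of_ne_zero_of_inner_eq_zero hne horth
  have hli' : LinearIndependent ℂ fun n =>
      (⟨v n, hmem n⟩ : Module.End.eigenspace (cutLine (Set.Ioo c d)).toLinearMap 1) :=
    LinearIndependent.of_comp (Submodule.subtype _) hli
  have := hli'.finite_of_isNoetherian
  exact not_finite ℕ

/-- Restriction of functions to a set. -/
noncomputable def restrictLine (s : Set ℝ) : L2Line →L[ℂ] Lp ℂ 2 (volume.restrict s) :=
  LpToLpRestrictCLM ℝ ℂ ℂ volume 2 s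

/-- Extension of functions by zero. -/
noncomputable def extendLine (s : Set ℝ) : Lp ℂ 2 (volume.restrict s) →L[ℂ] L2Line :=
  ContinuousLinearMap.adjoint (restrictLine s)

theorem coeFn_restrictLine (s : Set ℝ) (f : L2Line) :
    restrictLine s f =ᵐ[volume.restrict s] f :=
  LpToLpRestrictCLM_coeFn ℂ s f

theorem coeFn_extendLine {s : Set ℝ} (hs : MeasurableSet s) (f : Lp ℂ 2 (volume.restrict s)) :
    extendLine s f =ᵐ[volume] s.indicator f := by
  have hmem : MemLp (s.indicator f) 2 volume :=
    (memLp_indicator_iff_restrict hs).2 (Lp.memLp f)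
  have : extendLine s f = hmem.toLp _ := by
    refine ext_inner_left ℂ fun g => ?_
    rw [extendLine, ContinuousLinearMap.adjoint_inner_right, L2.inner_def, L2.inner_def]
    have h1 : ∫ x, inner ℂ (g x) (hmem.toLp _ x) =
        ∫ x, s.indicator (fun x => inner ℂ (g x) (f x)) x := by
      refine integral_congr_ae ?_
      filter_upwards [hmem.coeFn_toLp] with x hx
      rw [hx]
      by_cases hxs : x ∈ s <;> simp [hxs]
    rw [h1, integral_indicator hs]
    refine integral_congr_ae ?_
    filter_upwards [coeFn_restrictLine s g] with x hx
    rw [hx]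
  rw [this]
  exact hmem.coeFn_toLp

theorem restrictLine_extendLine {s : Set ℝ} (hs : MeasurableSet s)
    (f : Lp ℂ 2 (volume.restrict s)) : restrictLine s (extendLine s f) = f := by
  refine Lp.ext ?_
  filter_upwards [coeFn_restrictLine s (extendLine s f),
    ae_restrict_of_ae (coeFn_extendLine hs f), ae_restrict_mem hs] with x h1 h2 h3
  rw [h1, h2, Set.indicator_of_mem h3]

theorem extendLine_restrictLine {s : Set ℝ} (hs : MeasurableSet s) (f : L2Line) :
    extendLine s (restrictLine s f) = cutLine s f := by
  refine Lp.ext ?_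
  filter_upwards [coeFn_extendLine hs (restrictLine s f),
    coeFn_mulLine (isMultiplier_indicator hs) f,
    (ae_restrict_iff' hs).1 (coeFn_restrictLine s f)] with x h1 h2 h3
  rw [h1, h2]
  by_cases hx : x ∈ s
  · simp [hx, h3 hx]
  · simp [hx]

theorem adjoint_hilbertLine : ContinuousLinearMap.adjoint hilbertLine = -hilbertLine :=
  ((ContinuousLinearMap.eq_adjoint_iff _ _).2 fun f g => by
    simp [inner_hilbertLine_left f g]).symm

/-! ### The truncated transform and the compactness of `A (1 - A)` -/

/-- The truncated Hilbert transform. -/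
noncomputable def truncatedHilbert (a₁ a₂ a₃ a₄ : ℝ) : L2Interval a₂ a₄ →L[ℂ] L2Interval a₁ a₃ :=
  restrictLine (Set.Ioo a₁ a₃) ∘L hilbertLine ∘L extendLine (Set.Ioo a₂ a₄)

theorem isTruncatedHilbert_truncatedHilbert (a₁ a₂ a₃ a₄ : ℝ) :
    IsTruncatedHilbert a₁ a₂ a₃ a₄ (truncatedHilbert a₁ a₂ a₃ a₄) := by
  intro f
  set F := extendLine (Set.Ioo a₂ a₄) f with hF
  filter_upwards [ae_restrict_of_ae (ae_tendsto_hilbertLine F),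
    coeFn_restrictLine (Set.Ioo a₁ a₃) (hilbertLine F)] with x h1 h2
  have h3 : truncatedHilbert a₁ a₂ a₃ a₄ f x = hilbertLine F x := h2
  rw [HasPVHilbert, h3]
  refine h1.congr fun ε => ?_
  rw [cutoffHilbert]
  congr 1
  have h4 : ∫ y in {y : ℝ | ε < |y - x|}, F y / ((y : ℂ) - x) =
      ∫ y in {y : ℝ | ε < |y - x|},
        (Set.Ioo a₂ a₄).indicator (fun y => f y / ((y : ℂ) - x)) y := by
    refine integral_congr_ae (ae_restrict_of_ae ?_)
    filter_upwards [coeFn_extendLine measurableSet_Ioo f] with y hy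
    rw [hF, hy]
    by_cases h : y ∈ Set.Ioo a₂ a₄ <;> simp [h]
  rw [h4, setIntegral_indicator measurableSet_Ioo]
  congr 2
  ext y
  exact and_comm

section Compactness

variable {a₁ a₂ a₃ a₄ : ℝ}

theorem adjoint_truncatedHilbert_apply (g : L2Interval a₁ a₃) :
    ContinuousLinearMap.adjoint (truncatedHilbert a₁ a₂ a₃ a₄) g =
      -restrictLine (Set.Ioo a₂ a₄) (hilbertLine (extendLine (Set.Ioo a₁ a₃) g)) := by
  rw [truncatedHilbert, ContinuousLinearMap.adjoint_comp, ContinuousLinearMap.adjoint_comp,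
    adjoint_hilbertLine, extendLine, extendLine, ContinuousLinearMap.adjoint_adjoint]
  simp

/-- The operator `T* T` for the truncated Hilbert transform `T`. -/
noncomputable def gramHilbert (a₁ a₂ a₃ a₄ : ℝ) : L2Interval a₂ a₄ →L[ℂ] L2Interval a₂ a₄ :=
  ContinuousLinearMap.adjoint (truncatedHilbert a₁ a₂ a₃ a₄) ∘L truncatedHilbert a₁ a₂ a₃ a₄

theorem gramHilbert_apply (f : L2Interval a₂ a₄) :
    gramHilbert a₁ a₂ a₃ a₄ f = -restrictLine (Set.Ioo a₂ a₄) (hilbertLine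
      (cutLine (Set.Ioo a₁ a₃) (hilbertLine (extendLine (Set.Ioo a₂ a₄) f)))) := by
  rw [gramHilbert, ContinuousLinearMap.comp_apply, adjoint_truncatedHilbert_apply,
    ← extendLine_restrictLine measurableSet_Ioo]
  rfl

/-- The two cutoffs add up to the identity, and `H² = -1` compresses to `-1`. This puts `1 - A` in
the same form as `A`. -/
theorem sub_gramHilbert_apply (f : L2Interval a₂ a₄) :
    f - gramHilbert a₁ a₂ a₃ a₄ f = -restrictLine (Set.Ioo a₂ a₄) (hilbertLine
      (cutLine (Set.Ioo a₁ a₃)ᶜ (hilbertLine (extendLine (Set.Ioo a₂ a₄) f)))) := by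
  have h1 := cutLine_add_compl (measurableSet_Ioo (a := a₁) (b := a₃))
    (hilbertLine (extendLine (Set.Ioo a₂ a₄) f))
  have h2 := congrArg (fun g => restrictLine (Set.Ioo a₂ a₄) (hilbertLine g)) h1
  simp only [map_add, hilbertLine_hilbertLine, map_neg,
    restrictLine_extendLine measurableSet_Ioo] at h2
  rw [gramHilbert_apply, sub_neg_eq_add, eq_neg_iff_add_eq_zero, add_assoc, h2, add_neg_cancel]

theorem isSymmetric_gramHilbert :
    (gramHilbert a₁ a₂ a₃ a₄ : L2Interval a₂ a₄ →ₗ[ℂ] L2Interval a₂ a₄).IsSymmetric := by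
  intro f g
  simp [gramHilbert, ContinuousLinearMap.adjoint_inner_left,
    ContinuousLinearMap.adjoint_inner_right]

/-- The middle cutoff is split into three. The piece at `a₂` is supported away from the complement
of `(a₁, a₃)`, and the piece at `a₄` away from `(a₁, a₃)`, so each is compact through one of its
neighbouring factors `H`. The remaining trapezoid is Lipschitz: commuting it past `H` leaves `H² =
-1` between disjoint cutoffs. -/
theorem isCompactOperator_core (h₁₂ : a₁ < a₂) (h₂₃ : a₂ < a₃) (h₃₄ : a₃ < a₄) :
    IsCompactOperator fun f : L2Line => cutLine (Set.Ioo a₁ a₃) (hilbertLine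
      (cutLine (Set.Ioo a₂ a₄) (hilbertLine (cutLine (Set.Ioo a₁ a₃)ᶜ f)))) := by
  obtain ⟨d, hd, hd1, hd2, hd3⟩ : ∃ d > 0, d ≤ a₂ - a₁ ∧ d ≤ a₃ - a₂ ∧ d ≤ a₄ - a₃ :=
    ⟨min (a₂ - a₁) (min (a₃ - a₂) (a₄ - a₃)),
      lt_min (sub_pos.2 h₁₂) (lt_min (sub_pos.2 h₂₃) (sub_pos.2 h₃₄)),
      min_le_left _ _, (min_le_right _ _).trans (min_le_left _ _),
      (min_le_right _ _).trans (min_le_right _ _)⟩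
  have hP := isMultiplier_indicator (measurableSet_Ioo (a := a₁) (b := a₃))
  have hP' := isMultiplier_indicator (measurableSet_Ioo (a := a₁) (b := a₃)).compl
  have hQ := isMultiplier_indicator (measurableSet_Ioo (a := a₂) (b := a₄))
  have b1 := isLipschitzBump_trapezoid (a₂ - d) (a₂ + d) hd
  have b2 := isLipschitzBump_trapezoid (a₄ - d) (a₄ + d) hd
  have b3 := isLipschitzBump_trapezoid a₂ a₄ hd
  have k1 := ((b1.isCompactOperator_mul_hilbert hP' fun x => by
      by_cases hx : x ∈ Set.Ioo a₁ a₃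
      · simp [hx]
      · rcases lt_or_ge a₁ x with h | h
        · have : a₃ ≤ x := not_lt.1 fun h' => hx ⟨h, h'⟩
          rw [trapezoid_of_right_le hd (by linarith), zero_mul]
        · rw [trapezoid_of_le_left hd (by linarith), zero_mul]).clm_comp
      (cutLine (Set.Ioo a₁ a₃) ∘L hilbertLine ∘L cutLine (Set.Ioo a₂ a₄)))
  have k2 := ((b2.isCompactOperator_hilbert_mul hP fun x => by
      by_cases hx : x ∈ Set.Ioo a₁ a₃
      · rw [trapezoid_of_le_left hd (by linarith [hx.2]), mul_zero]
      · simp [hx]).comp_clm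
      (cutLine (Set.Ioo a₂ a₄) ∘L hilbertLine ∘L cutLine (Set.Ioo a₁ a₃)ᶜ))
  have k3 := b3.isCompactOperator_mul_hilbert_hilbert_mul hP hP' fun x => by
      by_cases hx : x ∈ Set.Ioo a₁ a₃ <;> simp [hx]
  have hdec : ∀ g : L2Line, cutLine (Set.Ioo a₂ a₄) g =
      cutLine (Set.Ioo a₂ a₄) (mulLine (trapezoid (a₂ - d) (a₂ + d) d) g) +
      mulLine (trapezoid (a₄ - d) (a₄ + d) d) (cutLine (Set.Ioo a₂ a₄) g) +
      mulLine (trapezoid a₂ a₄ d) g := by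
    intro g
    refine Lp.ext ?_
    filter_upwards [Lp.coeFn_add (cutLine (Set.Ioo a₂ a₄)
        (mulLine (trapezoid (a₂ - d) (a₂ + d) d) g) +
        mulLine (trapezoid (a₄ - d) (a₄ + d) d) (cutLine (Set.Ioo a₂ a₄) g))
        (mulLine (trapezoid a₂ a₄ d) g),
      Lp.coeFn_add (cutLine (Set.Ioo a₂ a₄) (mulLine (trapezoid (a₂ - d) (a₂ + d) d) g))
        (mulLine (trapezoid (a₄ - d) (a₄ + d) d) (cutLine (Set.Ioo a₂ a₄) g)),
      coeFn_mulLine hQ g, coeFn_mulLine hQ (mulLine (trapezoid (a₂ - d) (a₂ + d) d) g),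
      coeFn_mulLine b1.isMultiplier g, coeFn_mulLine b2.isMultiplier (cutLine (Set.Ioo a₂ a₄) g),
      coeFn_mulLine b3.isMultiplier g] with x e1 e2 e3 e4 e5 e6 e7
    rw [e1, Pi.add_apply, e2, Pi.add_apply, e3, e4, e5, e6, e3, e7]
    by_cases hx : x ∈ Set.Ioo a₂ a₄
    · have := trapezoid_partition hd (by linarith) hx.1 hx.2
      simp only [hx, Set.indicator_of_mem, Pi.one_apply, Complex.ofReal_one, one_mul]
      rw [← add_mul, ← add_mul, ← Complex.ofReal_add, ← Complex.ofReal_add, this,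
        Complex.ofReal_one, one_mul]
    · have : trapezoid a₂ a₄ d x = 0 := by
        rcases lt_or_ge a₂ x with h | h
        · exact trapezoid_of_right_le hd (not_lt.1 fun h' => hx ⟨h, h'⟩)
        · exact trapezoid_of_le_left hd h
      simp [hx, this]
  refine ((k1.add k2).add k3).of_forall_eq fun f => ?_
  rw [hdec]
  simp only [map_add, Pi.add_apply, Function.comp_apply, ContinuousLinearMap.comp_apply]

theorem isCompactOperator_gramHilbert_mul (h₁₂ : a₁ < a₂) (h₂₃ : a₂ < a₃) (h₃₄ : a₃ < a₄) :
    IsCompactOperator ((gramHilbert a₁ a₂ a₃ a₄ * (1 - gramHilbert a₁ a₂ a₃ a₄) :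
      L2Interval a₂ a₄ →L[ℂ] L2Interval a₂ a₄) : L2Interval a₂ a₄ → L2Interval a₂ a₄) := by
  refine (((isCompactOperator_core h₁₂ h₂₃ h₃₄).comp_clm
    (hilbertLine ∘L extendLine (Set.Ioo a₂ a₄))).clm_comp
    (restrictLine (Set.Ioo a₂ a₄) ∘L hilbertLine)).of_forall_eq fun f => ?_
  simp only [mul_apply_eq_comp, sub_apply,
    one_apply_eq_self]
  rw [gramHilbert_apply, sub_gramHilbert_apply, map_neg, extendLine_restrictLine measurableSet_Ioo]
  simp

/-! ### Non-invertibility at `0` and `1`, and non-compactness -/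

/-- Compression of the multiplication by an indicator to a subinterval. -/
noncomputable def cutInterval (s : Set ℝ) (a b : ℝ) : L2Interval a b →L[ℂ] L2Interval a b :=
  restrictLine (Set.Ioo a b) ∘L cutLine s ∘L extendLine (Set.Ioo a b)

theorem not_isCompactOperator_cutInterval {a b c d : ℝ} (hcd : c < d)
    (hsub : Set.Ioo c d ⊆ Set.Ioo a b) : ¬ IsCompactOperator (cutInterval (Set.Ioo c d) a b) := by
  intro h
  refine not_isCompactOperator_cutLine hcd (((h.comp_clm (restrictLine (Set.Ioo a b))).clm_comp
    (extendLine (Set.Ioo a b))).of_forall_eq fun f => ?_)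
  simp only [Function.comp_apply, cutInterval, ContinuousLinearMap.comp_apply,
    extendLine_restrictLine measurableSet_Ioo]
  rw [cutLine_cutLine_of_subset measurableSet_Ioo measurableSet_Ioo hsub]
  refine (mulLine_mulLine (isMultiplier_indicator measurableSet_Ioo)
    (isMultiplier_indicator measurableSet_Ioo) (isMultiplier_indicator measurableSet_Ioo)
    (fun x => ?_) f).symm
  by_cases hx : x ∈ Set.Ioo c d
  · simp [hx, hsub hx]
  · simp [hx]

/-- `φ H` is compact on functions supported where a Lipschitz bump orthogonal to `φ` is one. -/
theorem isCompactOperator_cut_hilbert_cut {s t : Set ℝ} (hs : MeasurableSet s)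
    (ht : MeasurableSet t) {ψ : ℝ → ℝ} {L R : ℝ} (hψ : IsLipschitzBump ψ L R)
    (h0 : ∀ x ∈ s, ψ x = 0) (h1 : ∀ x ∈ t, ψ x = 1) :
    IsCompactOperator fun f : L2Line => cutLine s (hilbertLine (cutLine t f)) := by
  refine ((hψ.isCompactOperator_hilbert_mul (isMultiplier_indicator hs) fun x => by
    by_cases hx : x ∈ s <;> simp [hx, h0]).comp_clm (cutLine t)).of_forall_eq fun f => ?_
  rw [Function.comp_apply, mulLine_mulLine hψ.isMultiplier (isMultiplier_indicator ht)
    (isMultiplier_indicator ht) fun x => by by_cases hx : x ∈ t <;> simp [hx, h1]]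

/-- The interval `((a₃ + a₄) / 2, a₄)` has positive distance from `(a₁, a₃)`, so a trapezoid
starting at `a₃` separates the two and the inner factor `P H` is compact there. -/
theorem isCompactOperator_gramHilbert_cut (h₂₃ : a₂ < a₃) (h₃₄ : a₃ < a₄) :
    IsCompactOperator ((gramHilbert a₁ a₂ a₃ a₄ ∘L
      cutInterval (Set.Ioo ((a₃ + a₄) / 2) a₄) a₂ a₄ : L2Interval a₂ a₄ →L[ℂ] L2Interval a₂ a₄) :
      L2Interval a₂ a₄ → L2Interval a₂ a₄) := by
  have hd : 0 < (a₄ - a₃) / 2 := by linarith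
  have h := isCompactOperator_cut_hilbert_cut (measurableSet_Ioo (a := a₁) (b := a₃))
    (measurableSet_Ioo (a := (a₃ + a₄) / 2) (b := a₄))
    (isLipschitzBump_trapezoid a₃ (a₄ + (a₄ - a₃) / 2) hd)
    (fun x hx => trapezoid_of_le_left hd hx.2.le)
    (fun x hx => trapezoid_eq_one hd (by linarith [hx.1]) (by linarith [hx.2]))
  refine ((h.comp_clm (extendLine (Set.Ioo a₂ a₄))).clm_comp
    (restrictLine (Set.Ioo a₂ a₄) ∘L hilbertLine)).neg.of_forall_eq fun f => ?_
  rw [ContinuousLinearMap.comp_apply, gramHilbert_apply, cutInterval]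
  simp only [ContinuousLinearMap.comp_apply, extendLine_restrictLine measurableSet_Ioo]
  rw [cutLine_cutLine_of_subset measurableSet_Ioo measurableSet_Ioo
    (Set.Ioo_subset_Ioo_left (by linarith))]
  rfl

/-- Here `(a₂, (a₂ + a₃) / 2)` has positive distance from the complement of `(a₁, a₃)`, which is the
cutoff occurring in `1 - A`. -/
theorem isCompactOperator_sub_gramHilbert_cut (h₁₂ : a₁ < a₂) (h₂₃ : a₂ < a₃) (h₃₄ : a₃ < a₄) :
    IsCompactOperator (((1 - gramHilbert a₁ a₂ a₃ a₄) ∘L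
      cutInterval (Set.Ioo a₂ ((a₂ + a₃) / 2)) a₂ a₄ : L2Interval a₂ a₄ →L[ℂ] L2Interval a₂ a₄) :
      L2Interval a₂ a₄ → L2Interval a₂ a₄) := by
  obtain ⟨d, hd, hd1, hd2⟩ : ∃ d > 0, d ≤ a₂ - a₁ ∧ d ≤ (a₃ - a₂) / 2 :=
    ⟨min (a₂ - a₁) ((a₃ - a₂) / 2), lt_min (sub_pos.2 h₁₂) (by linarith),
      min_le_left _ _, min_le_right _ _⟩
  have h := isCompactOperator_cut_hilbert_cut (measurableSet_Ioo (a := a₁) (b := a₃)).compl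
    (measurableSet_Ioo (a := a₂) (b := (a₂ + a₃) / 2)) (isLipschitzBump_trapezoid a₁ a₃ hd)
    (fun x hx => by
      rcases lt_or_ge a₁ x with h | h
      · exact trapezoid_of_right_le hd (not_lt.1 fun h' => hx ⟨h, h'⟩)
      · exact trapezoid_of_le_left hd h)
    (fun x hx => trapezoid_eq_one hd (by linarith [hx.1]) (by linarith [hx.2]))
  refine ((h.comp_clm (extendLine (Set.Ioo a₂ a₄))).clm_comp
    (restrictLine (Set.Ioo a₂ a₄) ∘L hilbertLine)).neg.of_forall_eq fun f => ?_
  rw [ContinuousLinearMap.comp_apply, sub_apply, one_apply_eq_self,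
    sub_gramHilbert_apply, cutInterval]
  simp only [ContinuousLinearMap.comp_apply, extendLine_restrictLine measurableSet_Ioo]
  rw [cutLine_cutLine_of_subset measurableSet_Ioo measurableSet_Ioo
    (Set.Ioo_subset_Ioo_right (by linarith))]
  rfl

/-- An inverse of `A` would exhibit `B = A⁻¹ (A B)` as compact. -/
theorem not_isUnit_of_isCompactOperator_comp {E : Type*} [NormedAddCommGroup E] [NormedSpace ℂ E]
    {A B : E →L[ℂ] E} (hAB : IsCompactOperator ((A ∘L B : E →L[ℂ] E) : E → E))
    (hB : ¬ IsCompactOperator B) : ¬ IsUnit A := by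
  rintro ⟨u, rfl⟩
  refine hB ((hAB.clm_comp (u⁻¹ : (E →L[ℂ] E)ˣ).val).of_forall_eq fun x => ?_)
  have : ((u⁻¹ : (E →L[ℂ] E)ˣ).val * u.val) (B x) = B x := by simp
  exact this.symm

theorem not_isUnit_gramHilbert (h₂₃ : a₂ < a₃) (h₃₄ : a₃ < a₄) :
    ¬ IsUnit (gramHilbert a₁ a₂ a₃ a₄) :=
  not_isUnit_of_isCompactOperator_comp (isCompactOperator_gramHilbert_cut h₂₃ h₃₄)
    (not_isCompactOperator_cutInterval (by linarith) (Set.Ioo_subset_Ioo_left (by linarith)))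

theorem not_isUnit_sub_gramHilbert (h₁₂ : a₁ < a₂) (h₂₃ : a₂ < a₃) (h₃₄ : a₃ < a₄) :
    ¬ IsUnit (1 - gramHilbert a₁ a₂ a₃ a₄) :=
  not_isUnit_of_isCompactOperator_comp (isCompactOperator_sub_gramHilbert_cut h₁₂ h₂₃ h₃₄)
    (not_isCompactOperator_cutInterval (by linarith) (Set.Ioo_subset_Ioo_right (by linarith)))

/-- If `T` were compact, so would be `A = T* T`, and adding `1 - A` on functions near `a₂` would
make an interval cutoff compact. -/
theorem not_isCompactOperator_truncatedHilbert (h₁₂ : a₁ < a₂) (h₂₃ : a₂ < a₃) (h₃₄ : a₃ < a₄) :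
    ¬ IsCompactOperator (truncatedHilbert a₁ a₂ a₃ a₄) := by
  intro h
  refine not_isCompactOperator_cutInterval (a := a₂) (b := a₄) (c := a₂) (d := (a₂ + a₃) / 2)
    (by linarith) (Set.Ioo_subset_Ioo_right (by linarith)) ?_
  refine ((isCompactOperator_sub_gramHilbert_cut h₁₂ h₂₃ h₃₄).add
    ((h.clm_comp (ContinuousLinearMap.adjoint (truncatedHilbert a₁ a₂ a₃ a₄))).comp_clm
      (cutInterval (Set.Ioo a₂ ((a₂ + a₃) / 2)) a₂ a₄))).of_forall_eq fun f => ?_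
  simp [gramHilbert]

end Compactness

/-! ### Uniqueness from vanishing of the transform on an interval -/

/-- Stieltjes-type integrals may be differentiated off the support. -/
theorem hasDerivAt_integral_inv_pow {F : ℝ → ℂ} (hF : Integrable F) {p : ℝ}
    (hsupp : ∀ᵐ y, y ≤ p → F y = 0) (n : ℕ) {x : ℝ} (hx : x < p) :
    HasDerivAt (fun x => ∫ y, ((y - x)⁻¹ ^ (n + 1)) • F y)
      (((n : ℝ) + 1) • ∫ y, ((y - x)⁻¹ ^ (n + 2)) • F y) x := by
  -- Half the distance to the support: for `z` within `δ` of `x`, every `y > p` satisfies `y - z ≥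
  -- δ`.
  set δ := (p - x) / 2 with hδdef
  have hδ : 0 < δ := by simp only [hδdef]; linarith
  have hm : ∀ (k : ℕ) (z : ℝ), AEStronglyMeasurable (fun y => ((y - z)⁻¹ ^ k) • F y) volume :=
    fun k z => (by fun_prop : Measurable fun y : ℝ => (y - z)⁻¹ ^ k).aestronglyMeasurable.smul hF.1
  have hlow : ∀ᵐ y, ∀ z ∈ Metric.ball x δ, F y = 0 ∨ δ ≤ y - z := by
    filter_upwards [hsupp] with y hy z hz
    rcases le_or_gt y p with h | h
    · exact Or.inl (hy h)
    · right
      have := (abs_lt.1 (Real.dist_eq z x ▸ Metric.mem_ball.1 hz)).2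
      simp only [hδdef] at *
      linarith
  have hbd : ∀ (k : ℕ), ∀ᵐ y, ∀ z ∈ Metric.ball x δ,
      ‖((y - z)⁻¹ ^ k) • F y‖ ≤ (δ⁻¹ ^ k) * ‖F y‖ := by
    intro k
    filter_upwards [hlow] with y hy z hz
    rcases hy z hz with h | h
    · simp [h]
    · have h' : 0 ≤ (y - z)⁻¹ := inv_nonneg.2 (hδ.le.trans h)
      rw [norm_smul, norm_pow, norm_inv, Real.norm_of_nonneg (hδ.le.trans h)]
      gcongr
  have hint : ∀ k : ℕ, Integrable (fun y => ((y - x)⁻¹ ^ k) • F y) := fun k =>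
    (hF.norm.const_mul (δ⁻¹ ^ k)).mono' (hm k x) (by
      filter_upwards [hbd k] with y hy
      exact hy x (Metric.mem_ball_self hδ))
  have hmc : ∀ z : ℝ, AEStronglyMeasurable
      (fun y => ((n : ℝ) + 1) • (((y - z)⁻¹ ^ (n + 2)) • F y)) volume :=
    fun z => (hm (n + 2) z).const_smul ((n : ℝ) + 1)
  have h := (hasDerivAt_integral_of_dominated_loc_of_deriv_le
    (F := fun z y => ((y - z)⁻¹ ^ (n + 1)) • F y)
    (F' := fun z y => ((n : ℝ) + 1) • (((y - z)⁻¹ ^ (n + 2)) • F y))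
    (bound := fun y => ((n : ℝ) + 1) * ((δ⁻¹ ^ (n + 2)) * ‖F y‖)) (x₀ := x)
    (Metric.ball_mem_nhds x hδ) (Eventually.of_forall fun z => hm _ z) (hint _)
    (hmc x) ?_ ((hF.norm.const_mul _).const_mul _) ?_).2
  · rwa [integral_smul] at h
  · filter_upwards [hbd (n + 2)] with y hy z hz
    rw [norm_smul, Real.norm_of_nonneg (by positivity)]
    gcongr
    exact hy z hz
  · filter_upwards [hlow] with y hy z hz
    rcases hy z hz with h | h
    · simpa [h] using hasDerivAt_const z (0 : ℂ)
    · have hne : y - z ≠ 0 := (hδ.trans_le h).ne'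
      have h1 : HasDerivAt (fun z : ℝ => y - z) (-1) z := by
        simpa using (hasDerivAt_id z).const_sub y
      have h2 := ((h1.inv hne).pow (n + 1)).smul_const (F y)
      rw [smul_smul]
      refine h2.congr_deriv ?_
      congr 1
      push_cast
      rw [Pi.inv_apply, neg_neg, one_div, ← inv_pow]
      ring

/-- The moments of `F` with respect to `1 / (y - x₀)` determine `F`. -/
theorem ae_eq_zero_of_integral_inv_pow {F : ℝ → ℂ} (hF : Integrable F) {p q x₀ : ℝ} (hx₀ : x₀ < p)
    (hpq : p < q) (hsupp : ∀ᵐ y, y ∉ Set.Ioo p q → F y = 0)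
    (h0 : ∀ n : ℕ, ∫ y, ((y - x₀)⁻¹ ^ (n + 1)) • F y = 0) : F =ᵐ[volume] 0 := by
  have hp : 0 < p - x₀ := sub_pos.2 hx₀
  -- The moments start at exponent `1`; absorbing one factor into `K` leaves all powers from `0`,
  -- hence all polynomials in `(y - x₀)⁻¹`.
  set K : ℝ → ℂ := fun y => (y - x₀)⁻¹ • F y with hKdef
  have hu : ∀ y ∈ Set.Ioo p q, 0 < (y - x₀)⁻¹ ∧ (q - x₀)⁻¹ ≤ (y - x₀)⁻¹ ∧
      (y - x₀)⁻¹ ≤ (p - x₀)⁻¹ := by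
    intro y hy
    have : 0 < y - x₀ := by linarith [hy.1]
    refine ⟨inv_pos.2 this, ?_, ?_⟩
    · exact inv_anti₀ this (by linarith [hy.2])
    · exact inv_anti₀ hp (by linarith [hy.1])
  have hKint : ∀ k : ℕ, Integrable fun y => ((y - x₀)⁻¹ ^ k) • F y := fun k => by
    refine (hF.norm.const_mul ((p - x₀)⁻¹ ^ k)).mono'
      ((by fun_prop : Measurable fun y : ℝ => (y - x₀)⁻¹ ^ k).aestronglyMeasurable.smul hF.1) ?_
    filter_upwards [hsupp] with y hy
    by_cases h : y ∈ Set.Ioo p q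
    · obtain ⟨h1, -, h3⟩ := hu y h
      rw [norm_smul, norm_pow, Real.norm_of_nonneg h1.le]
      gcongr
    · simp [hy h]
  have hK1 : Integrable K := by simpa [hKdef] using hKint 1
  have hpoly : ∀ P : Polynomial ℝ, ∫ y, (P.eval (y - x₀)⁻¹) • K y = 0 := by
    intro P
    have : ∀ y, (P.eval (y - x₀)⁻¹) • K y = ∑ i ∈ Finset.range (P.natDegree + 1),
        P.coeff i • (((y - x₀)⁻¹ ^ (i + 1)) • F y) := fun y => by
      rw [Polynomial.eval_eq_sum_range, Finset.sum_smul]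
      refine Finset.sum_congr rfl fun i _ => ?_
      rw [hKdef, smul_smul, smul_smul, pow_succ, mul_assoc]
    have hi : ∀ i : ℕ, Integrable fun y => P.coeff i • (((y - x₀)⁻¹ ^ (i + 1)) • F y) :=
      fun i => (hKint (i + 1)).smul (P.coeff i)
    simp_rw [this]
    rw [integral_finsetSum _ fun i _ => hi i]
    refine Finset.sum_eq_zero fun i _ => ?_
    rw [integral_smul, h0, smul_zero]
  have hPint : ∀ φ : ℝ → ℝ, ∀ C, Measurable φ → (∀ y ∈ Set.Ioo p q, |φ y| ≤ C) →
      Integrable fun y => φ y • K y := by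
    intro φ C hφ hb
    refine (hK1.norm.const_mul C).mono' (hφ.aestronglyMeasurable.smul hK1.1) ?_
    filter_upwards [hsupp] with y hy
    by_cases h : y ∈ Set.Ioo p q
    · rw [norm_smul]
      gcongr
      exact hb y h
    · simp [hKdef, hy h]
  have hK0 : ∀ᵐ y, K y = 0 := by
    refine ae_eq_zero_of_integral_contDiff_smul_eq_zero hK1.locallyIntegrable fun g hg hgc => ?_
    rw [← norm_le_zero_iff]
    refine le_of_forall_pos_le_add fun ε hε => ?_
    set I := ∫ y, ‖K y‖ with hI
    have hI0 : 0 ≤ I := integral_nonneg fun y => norm_nonneg _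
    -- In the variable `u = (y - x₀)⁻¹` the support lies in a compact interval away from `0`, so
    -- Weierstrass approximation applies to the test function.
    have hcont : ContinuousOn (fun u : ℝ => g (x₀ + u⁻¹)) (Set.Icc (q - x₀)⁻¹ (p - x₀)⁻¹) := by
      refine hg.continuous.comp_continuousOn (continuousOn_const.add (continuousOn_id.inv₀ ?_))
      intro u hu
      have : 0 < (q - x₀)⁻¹ := inv_pos.2 (by linarith)
      exact (this.trans_le hu.1).ne'
    obtain ⟨P, hP⟩ := exists_polynomial_near_of_continuousOn _ _ _ hcont (ε / (I + 1))
      (by positivity)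
    have hnear : ∀ y ∈ Set.Ioo p q, |g y - P.eval (y - x₀)⁻¹| ≤ ε / (I + 1) := by
      intro y hy
      have := hP _ ⟨(hu y hy).2.1, (hu y hy).2.2⟩
      rw [inv_inv, add_sub_cancel, abs_sub_comm] at this
      exact this.le
    have hPm : Measurable fun y : ℝ => P.eval (y - x₀)⁻¹ :=
      P.continuous.measurable.comp (by fun_prop)
    have hgm : Measurable g := hg.continuous.measurable
    obtain ⟨Cg, hCg⟩ := hg.continuous.bounded_above_of_compact_support hgc
    have i1 := hPint g Cg hgm fun y _ => hCg y
    have i2 := hPint (fun y => g y - P.eval (y - x₀)⁻¹) _ (hgm.sub hPm) hnear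
    have i3 : ∫ y, g y • K y = ∫ y, (g y - P.eval (y - x₀)⁻¹) • K y := by
      have i4 : Integrable fun y => (P.eval (y - x₀)⁻¹) • K y := by
        refine (i1.sub i2).congr (Eventually.of_forall fun y => ?_)
        simp [sub_smul]
      simp_rw [sub_smul]
      rw [integral_sub i1 i4, hpoly, sub_zero]
    rw [i3]
    calc ‖∫ y, (g y - P.eval (y - x₀)⁻¹) • K y‖ ≤ ∫ y, ε / (I + 1) * ‖K y‖ := by
          refine norm_integral_le_of_norm_le (hK1.norm.const_mul _) ?_
          filter_upwards [hsupp] with y hy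
          by_cases h : y ∈ Set.Ioo p q
          · rw [norm_smul]
            gcongr
            exact hnear y h
          · simp [hKdef, hy h]
      _ = ε / (I + 1) * I := by rw [integral_const_mul]
      _ ≤ 0 + ε := by
          rw [zero_add, div_mul_eq_mul_div, div_le_iff₀ (by positivity)]
          nlinarith
  filter_upwards [hK0, hsupp] with y h1 h2
  by_cases h : y ∈ Set.Ioo p q
  · exact (smul_eq_zero.1 h1).resolve_left (hu y h).1.ne'
  · exact h2 h

/-- A function supported in `(p, q)` whose Hilbert transform vanishes on an interval to the left
of `p` is zero. -/
theorem eq_zero_of_hilbertLine_eq_zero {F : L2Line} {p q c d : ℝ} (hpq : p < q) (hcd : c < d)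
    (hdp : d ≤ p) (hsupp : ∀ᵐ y, y ∉ Set.Ioo p q → F y = 0)
    (hH : ∀ᵐ x, x ∈ Set.Ioo c d → hilbertLine F x = 0) : F = 0 := by
  have hint : Integrable F := by
    have h1 : IntegrableOn F (Set.Ioo p q) :=
      ((Lp.memLp F).locallyIntegrable one_le_two).integrableOn_isCompact isCompact_Icc |>.mono_set
        Set.Ioo_subset_Icc_self
    exact h1.integrable_of_ae_notMem_eq_zero hsupp
  have hsupp' : ∀ᵐ y, y ≤ p → F y = 0 := by
    filter_upwards [hsupp] with y hy h
    exact hy fun h' => absurd h'.1 (not_lt.2 h)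
  have hder := fun (n : ℕ) (x : ℝ) (hx : x < p) => hasDerivAt_integral_inv_pow hint hsupp' n hx
  have hae : ∀ᵐ x, x ∈ Set.Ioo c d → ∫ y, ((y - x)⁻¹ ^ (0 + 1)) • F y = 0 := by
    filter_upwards [hH, ae_tendsto_hilbertLine F] with x h1 h2 hx
    rw [h1 hx] at h2
    have hlim : Tendsto (fun ε : ℝ => (1 / (Real.pi : ℂ)) *
        ∫ y in {y : ℝ | ε < |y - x|}, F y / ((y : ℂ) - x)) (𝓝[>] 0)
        (𝓝 ((1 / (Real.pi : ℂ)) * ∫ y, ((y - x)⁻¹ ^ (0 + 1)) • F y)) := by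
      -- Once `ε < p - x`, the truncation removes none of the support of `F`.
      refine tendsto_const_nhds.congr' ?_
      have hxp : 0 < p - x := by linarith [hx.2]
      filter_upwards [nhdsWithin_le_nhds (gt_mem_nhds hxp)] with ε hε
      congr 1
      rw [setIntegral_eq_integral_of_ae_compl_eq_zero]
      · refine integral_congr_ae (Eventually.of_forall fun y => ?_)
        simp only [zero_add, pow_one, Complex.real_smul]
        push_cast
        rw [div_eq_mul_inv, mul_comm]
      · filter_upwards [hsupp'] with y hy h
        rw [hy, zero_div]
        by_contra! hlt
        exact h (lt_of_lt_of_le (by linarith) (le_abs_self (y - x)))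
    have h3 := tendsto_nhds_unique hlim h2
    refine (mul_eq_zero.1 h3).resolve_left ?_
    exact one_div_ne_zero (Complex.ofReal_ne_zero.2 Real.pi_ne_zero)
  -- Continuity upgrades vanishing almost everywhere to everywhere for the first moment;
  -- differentiating on the open interval gives the others.
  have hzero : ∀ n : ℕ, ∀ x ∈ Set.Ioo c d, ∫ y, ((y - x)⁻¹ ^ (n + 1)) • F y = 0 := by
    intro n
    induction n with
    | zero =>
      have hc : ContinuousOn (fun x => ∫ y, ((y - x)⁻¹ ^ (0 + 1)) • F y) (Set.Ioo c d) :=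
        fun x hx => (hder 0 x (hx.2.trans_le hdp)).continuousAt.continuousWithinAt
      exact Measure.eqOn_open_of_ae_eq ((ae_restrict_iff' measurableSet_Ioo).2 hae) isOpen_Ioo hc
        continuousOn_const
    | succ n ih =>
      intro x hx
      have h1 : HasDerivAt (fun x => ∫ y, ((y - x)⁻¹ ^ (n + 1)) • F y) 0 x :=
        (hasDerivAt_const x (0 : ℂ)).congr_of_eventuallyEq
          (by filter_upwards [isOpen_Ioo.mem_nhds hx] with z hz using ih z hz)
      have h2 := (hder n x (hx.2.trans_le hdp)).unique h1
      exact (smul_eq_zero.1 h2).resolve_left (by positivity)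
  have hmid : (c + d) / 2 ∈ Set.Ioo c d := ⟨by linarith, by linarith⟩
  have := ae_eq_zero_of_integral_inv_pow hint (hmid.2.trans_le hdp) hpq hsupp fun n =>
    hzero n _ hmid
  exact Lp.ext (this.trans (Lp.coeFn_zero ℂ 2 volume).symm)

/-! ### Eigenvalues and singular values -/

section Spectrum

variable {a₁ a₂ a₃ a₄ : ℝ}

theorem extendLine_support {a b : ℝ} (f : L2Interval a b) :
    ∀ᵐ y, y ∉ Set.Ioo a b → extendLine (Set.Ioo a b) f y = 0 := by
  filter_upwards [coeFn_extendLine measurableSet_Ioo f] with y hy h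
  rw [hy, Set.indicator_of_notMem h]

theorem eq_zero_of_extendLine_eq_zero {a b : ℝ} {f : L2Interval a b}
    (h : extendLine (Set.Ioo a b) f = 0) : f = 0 := by
  rw [← restrictLine_extendLine measurableSet_Ioo f, h, map_zero]

theorem ae_eq_zero_of_cutLine_eq_zero {s : Set ℝ} (hs : MeasurableSet s) {g : L2Line}
    (h : cutLine s g = 0) : ∀ᵐ x, x ∈ s → g x = 0 := by
  have h1 := coeFn_mulLine (isMultiplier_indicator hs) g
  change cutLine s g =ᵐ[volume] _ at h1
  rw [h] at h1
  filter_upwards [h1, Lp.coeFn_zero ℂ 2 volume] with x hx h0 hxs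
  rw [h0] at hx
  simpa [hxs] using hx.symm

/-- The truncated Hilbert transform is injective. -/
theorem eq_zero_of_gramHilbert_eq_zero (h₁₂ : a₁ < a₂) (h₂₃ : a₂ < a₃) (h₃₄ : a₃ < a₄)
    {f : L2Interval a₂ a₄} (hf : gramHilbert a₁ a₂ a₃ a₄ f = 0) : f = 0 := by
  have h1 : truncatedHilbert a₁ a₂ a₃ a₄ f = 0 := by
    rw [← inner_self_eq_zero (𝕜 := ℂ), ← ContinuousLinearMap.adjoint_inner_right]
    change inner ℂ f (gramHilbert a₁ a₂ a₃ a₄ f) = 0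
    rw [hf, inner_zero_right]
  refine eq_zero_of_extendLine_eq_zero (eq_zero_of_hilbertLine_eq_zero (h₂₃.trans h₃₄) h₁₂ le_rfl
    (extendLine_support f) ?_)
  have h2 : cutLine (Set.Ioo a₁ a₃) (hilbertLine (extendLine (Set.Ioo a₂ a₄) f)) = 0 := by
    rw [← extendLine_restrictLine measurableSet_Ioo]
    exact (congrArg _ h1).trans (map_zero _)
  filter_upwards [ae_eq_zero_of_cutLine_eq_zero measurableSet_Ioo h2] with x hx h
  exact hx ⟨h.1, h.2.trans h₂₃⟩

/-- No function in `L²(a₂, a₄)` has its Hilbert transform concentrated on `(a₁, a₃)`. -/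
theorem eq_zero_of_gramHilbert_eq_self (h₁₂ : a₁ < a₂) (h₂₄ : a₂ < a₄)
    {f : L2Interval a₂ a₄} (hf : gramHilbert a₁ a₂ a₃ a₄ f = f) : f = 0 := by
  set F := extendLine (Set.Ioo a₂ a₄) f with hF
  have h1 : cutLine (Set.Ioo a₁ a₃)ᶜ (hilbertLine F) = 0 := by
    have h2 := sub_gramHilbert_apply (a₁ := a₁) (a₃ := a₃) f
    rw [hf, sub_self, ← hF] at h2
    set g := cutLine (Set.Ioo a₁ a₃)ᶜ (hilbertLine F) with hg
    -- As `g` is a cutoff of `HF`, this inner product equals `‖g‖²`.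
    have h3 : inner ℂ (hilbertLine F) g = 0 := by
      rw [inner_hilbertLine_left, hF, extendLine, ContinuousLinearMap.adjoint_inner_left,
        neg_eq_zero.1 h2.symm, inner_zero_right, neg_zero]
    rw [← inner_self_eq_zero (𝕜 := ℂ)]
    rw [L2.inner_def] at h3 ⊢
    rw [← h3]
    refine integral_congr_ae ?_
    filter_upwards [coeFn_mulLine
      (isMultiplier_indicator (measurableSet_Ioo (a := a₁) (b := a₃)).compl) (hilbertLine F)]
      with x hx
    rw [hg, hx]
    by_cases h : x ∈ Set.Ioo a₁ a₃ <;> simp [h]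
  -- Any bounded interval to the left of `a₁` would serve; length `1` is arbitrary.
  refine eq_zero_of_extendLine_eq_zero (eq_zero_of_hilbertLine_eq_zero h₂₄ (c := a₁ - 1) (d := a₁)
    (by linarith) h₁₂.le (extendLine_support f) ?_)
  filter_upwards [ae_eq_zero_of_cutLine_eq_zero measurableSet_Ioo.compl h1] with x hx h
  exact hx fun h' => absurd h.2 (not_lt.2 h'.1.le)

/-- A positive eigenvalue of `T* T` yields a singular value of `T`. -/
theorem isSingularValue_sqrt {E F : Type*} [NormedAddCommGroup E] [InnerProductSpace ℂ E]
    [CompleteSpace E] [NormedAddCommGroup F] [InnerProductSpace ℂ F] [CompleteSpace F]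
    (T : E →L[ℂ] F) {l : ℝ} (hl0 : l ≠ 0)
    (hl : Module.End.HasEigenvalue
      ((ContinuousLinearMap.adjoint T ∘L T : E →L[ℂ] E) : Module.End ℂ E) (l : ℂ)) :
    0 < l ∧ IsSingularValue T √l := by
  obtain ⟨v, hv⟩ := hl.exists_hasEigenvector
  have hv1 : ContinuousLinearMap.adjoint T (T v) = (l : ℂ) • v := hv.apply_eq_smul
  have hvn : 0 < ‖v‖ := norm_pos_iff.2 hv.2
  have hnorm : ‖T v‖ ^ 2 = l * ‖v‖ ^ 2 := by
    have h1 : inner ℂ v (ContinuousLinearMap.adjoint T (T v)) = inner ℂ (T v) (T v) :=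
      ContinuousLinearMap.adjoint_inner_right T v (T v)
    rw [hv1, inner_smul_right, inner_self_eq_norm_sq_to_K, inner_self_eq_norm_sq_to_K] at h1
    refine Complex.ofReal_injective ?_
    push_cast
    exact h1.symm
  have hl1 : 0 < l := by
    have h0 : 0 ≤ l := by
      by_contra! h
      nlinarith [sq_nonneg ‖T v‖, mul_pos_of_neg_of_neg h (neg_lt_zero.2 (pow_pos hvn 2))]
    exact lt_of_le_of_ne h0 hl0.symm
  have hs : 0 < √l := Real.sqrt_pos.2 hl1
  have hTv : ‖T v‖ = √l * ‖v‖ := by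
    rw [← Real.sqrt_sq (norm_nonneg (T v)), hnorm, Real.sqrt_mul hl1.le,
      Real.sqrt_sq hvn.le]
  have hsC : (√l : ℂ) ≠ 0 := Complex.ofReal_ne_zero.2 hs.ne'
  have hss : (√l : ℂ) * √l = l := by
    rw [← Complex.ofReal_mul, Real.mul_self_sqrt hl1.le]
  refine ⟨hl1, hs.le, ((‖v‖⁻¹ : ℝ) : ℂ) • v, (√l : ℂ)⁻¹ • T (((‖v‖⁻¹ : ℝ) : ℂ) • v), ?_, ?_, ?_, ?_⟩
  · rw [norm_smul, Complex.norm_real, norm_inv, norm_norm, inv_mul_cancel₀ hvn.ne']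
  · rw [map_smul, norm_smul, norm_smul, norm_inv, Complex.norm_real, Complex.norm_real, norm_inv,
      norm_norm, hTv, Real.norm_of_nonneg hs.le]
    field_simp
  · rw [smul_smul, mul_inv_cancel₀ hsC, one_smul]
  · rw [map_smul, map_smul, map_smul, hv1, smul_smul, smul_smul, smul_smul]
    congr 1
    rw [← hss]
    field_simp

theorem not_hasEigenvalue_gramHilbert_zero (h₁₂ : a₁ < a₂) (h₂₃ : a₂ < a₃) (h₃₄ : a₃ < a₄) :
    ¬ Module.End.HasEigenvalue
      (gramHilbert a₁ a₂ a₃ a₄ : Module.End ℂ (L2Interval a₂ a₄)) 0 := fun h => by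
  obtain ⟨v, hv⟩ := h.exists_hasEigenvector
  refine hv.2 (eq_zero_of_gramHilbert_eq_zero h₁₂ h₂₃ h₃₄ ?_)
  simpa using hv.apply_eq_smul

theorem not_hasEigenvalue_gramHilbert_one (h₁₂ : a₁ < a₂) (h₂₄ : a₂ < a₄) :
    ¬ Module.End.HasEigenvalue
      (gramHilbert a₁ a₂ a₃ a₄ : Module.End ℂ (L2Interval a₂ a₄)) 1 := fun h => by
  obtain ⟨v, hv⟩ := h.exists_hasEigenvector
  refine hv.2 (eq_zero_of_gramHilbert_eq_self h₁₂ h₂₄ (a₃ := a₃) ?_)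
  simpa using hv.apply_eq_smul

/-- `0` and `1` are accumulation points of the singular values. -/
theorem accPt_isSingularValue (h₁₂ : a₁ < a₂) (h₂₃ : a₂ < a₃) (h₃₄ : a₃ < a₄) (c : ℝ)
    (hc : c = 0 ∨ c = 1) :
    AccPt c (𝓟 {σ : ℝ | IsSingularValue (truncatedHilbert a₁ a₂ a₃ a₄) σ}) := by
  have hd := orthogonal_iSup_eigenspace_eq_bot isSymmetric_gramHilbert
    (isCompactOperator_gramHilbert_mul h₁₂ h₂₃ h₃₄)
  have hev0 := not_hasEigenvalue_gramHilbert_zero h₁₂ h₂₃ h₃₄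
  have hev1 := not_hasEigenvalue_gramHilbert_one (a₃ := a₃) h₁₂ (h₂₃.trans h₃₄)
  have hunit : ¬ IsUnit (gramHilbert a₁ a₂ a₃ a₄ -
      (c : ℂ) • (1 : L2Interval a₂ a₄ →L[ℂ] L2Interval a₂ a₄)) := by
    rcases hc with rfl | rfl
    · simpa using not_isUnit_gramHilbert h₂₃ h₃₄
    · rw [Complex.ofReal_one, one_smul, ← IsUnit.neg_iff, neg_sub]
      exact not_isUnit_sub_gramHilbert h₁₂ h₂₃ h₃₄
  rw [accPt_iff_nhds]
  intro U hU
  obtain ⟨ε, hε, hεU⟩ := Metric.mem_nhds_iff.1 hU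
  -- At `c = 0` the bound `l < ε²` gives `√l < ε`; at `c = 1` the bound `|√l - 1| ≤ |l - 1|` needs
  -- only `ε`.
  have hε' : 0 < min ε (ε ^ 2) := lt_min hε (by positivity)
  obtain ⟨l, hl, hev⟩ := exists_hasEigenvalue_near isSymmetric_gramHilbert hd c hunit hε'
  have hl0 : l ≠ 0 := by
    rintro rfl
    exact hev0 (by simpa using hev)
  have hl1 : l ≠ 1 := by
    rintro rfl
    exact hev1 (by simpa using hev)
  obtain ⟨hpos, hsing⟩ := isSingularValue_sqrt _ hl0 hev
  refine ⟨√l, ⟨hεU ?_, hsing⟩, ?_⟩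
  · rw [Metric.mem_ball, Real.dist_eq]
    rcases hc with rfl | rfl
    · rw [sub_zero, abs_of_nonneg (Real.sqrt_nonneg _), Real.sqrt_lt' hε]
      rw [sub_zero, abs_of_pos hpos] at hl
      exact hl.trans_le (min_le_right _ _)
    · refine lt_of_le_of_lt ?_ (hl.trans_le (min_le_left _ _))
      have h1 : l - 1 = (√l - 1) * (√l + 1) := by
        linear_combination -(Real.mul_self_sqrt hpos.le)
      rw [h1, abs_mul]
      refine le_mul_of_one_le_right (abs_nonneg _) ?_
      rw [abs_of_pos (by positivity)]
      linarith [Real.sqrt_nonneg l]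
  · rcases hc with rfl | rfl
    · exact (Real.sqrt_pos.2 hpos).ne'
    · exact fun h => hl1 (Real.sqrt_eq_one.1 h)

end Spectrum

theorem mainTheorem2 (a₁ a₂ a₃ a₄ : ℝ) (h₁₂ : a₁ < a₂) (h₂₃ : a₂ < a₃) (h₃₄ : a₃ < a₄) :
    ∃ H_T : L2Interval a₂ a₄ →L[ℂ] L2Interval a₁ a₃,
      IsTruncatedHilbert a₁ a₂ a₃ a₄ H_T ∧
      (0 : ℂ) ∈ spectrum ℂ (ContinuousLinearMap.adjoint H_T ∘L H_T) ∧
      (1 : ℂ) ∈ spectrum ℂ (ContinuousLinearMap.adjoint H_T ∘L H_T) ∧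
      ¬ Module.End.HasEigenvalue
        ((ContinuousLinearMap.adjoint H_T ∘L H_T : L2Interval a₂ a₄ →L[ℂ] L2Interval a₂ a₄) :
          L2Interval a₂ a₄ →ₗ[ℂ] L2Interval a₂ a₄) (0 : ℂ) ∧
      ¬ Module.End.HasEigenvalue
        ((ContinuousLinearMap.adjoint H_T ∘L H_T : L2Interval a₂ a₄ →L[ℂ] L2Interval a₂ a₄) :
          L2Interval a₂ a₄ →ₗ[ℂ] L2Interval a₂ a₄) (1 : ℂ) ∧
      AccPt (0 : ℝ) (𝓟 {σ : ℝ | IsSingularValue H_T σ}) ∧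
      AccPt (1 : ℝ) (𝓟 {σ : ℝ | IsSingularValue H_T σ}) ∧
      ¬ IsCompactOperator H_T := by
  refine ⟨truncatedHilbert a₁ a₂ a₃ a₄, isTruncatedHilbert_truncatedHilbert a₁ a₂ a₃ a₄,
    ?_, ?_, not_hasEigenvalue_gramHilbert_zero h₁₂ h₂₃ h₃₄,
    not_hasEigenvalue_gramHilbert_one h₁₂ (h₂₃.trans h₃₄),
    accPt_isSingularValue h₁₂ h₂₃ h₃₄ 0 (Or.inl rfl),
    accPt_isSingularValue h₁₂ h₂₃ h₃₄ 1 (Or.inr rfl),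
    not_isCompactOperator_truncatedHilbert h₁₂ h₂₃ h₃₄⟩
  · rw [spectrum.zero_mem_iff]
    exact not_isUnit_gramHilbert h₂₃ h₃₄
  · rw [spectrum.mem_iff, map_one]
    exact not_isUnit_sub_gramHilbert h₁₂ h₂₃ h₃₄
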